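/- Let $L_n$ be the $n\times n$ lower triangular $0$-$1$ matrix (ones on and below the main diagonal) and let $\mathcal H_n$ be the set of all matrices obtained from $L_n$ by permuting rows and columns, i.e. the bipartite adjacency matrices of half graphs on $[n]\times[n]$. A learning algorithm must output a hidden $M\in\mathcal H_n$; it may query entries $M(i,j)$ at unit cost, and the quantum algorithms apply $O_M:|z\rangle|b\rangle\mapsto|z\rangle|b\oplus M(z)\rangle$, $z\in[n]\times[n]$, at unit cost. In the expected-cost setting it must output $M$ with probability $1$, may use random choices (randomized) or intermediate measurements (quantum), and its cost is the expected number of queries on the worst input $M\in\mathcal H_n$. Logarithms are to base $2$. Consider the following quicksort-type learner. To sort a list of rows restricted to a set of columns: if there is at most one row, stop; otherwise choose a uniformly random pivot row, query all its entries in the current columns, compare every other row with the pivot by a subroutine that searches for a column in which the two differ (a row that differs at a $1$ of the pivot is smaller, at a $0$ of the pivot larger), and recurse on the smaller rows restricted to the columns where the pivot is $1$ and on the larger rows restricted to the columns where the pivot is $0$. The learner sorts the rows, sorts the columns by the same procedure on the transposed matrix, and outputs the matrix determined by the two orders. There is an absolute constant $C>0$ such that for every $n\ge 1$: 1. (Randomized.)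 There is a randomized search subroutine that, for every bit string $x$ indexed by $[n]\times[n]$, every set $S$ of positions and every known string $p$ such that $x$ and $p$ differ in exactly $d\ge1$ positions of $S$, finds with probability $1$ a position of $S$ in which they differ, with at most $C\,|S|/d$ expected queries; and the quicksort-type learner using it is a randomized algorithm that learns every $M\in\mathcal H_n$ with probability $1$ and at most $C\,n\log^2 n$ expected queries. 2. (Quantum.) The same holds with a quantum search subroutine making at most $C\sqrt{|S|/d}$ expected queries, and the resulting quicksort-type quantum learner learns every $M\in\mathcal H_n$ with probability $1$ and at most $C\,n\log n$ expected queries. Moreover the quantum bound is tight: there is a constant $c>0$ such that for every $n\ge1$, every quantum query algorithm $U_0,O_M,U_1,O_M,\dots,O_M,U_T$ followed by a measurement that outputs $M$ with probability at least $2/3$ for every $M\in\mathcal H_n$ uses $T\ge c\,n\log n$ queries. -/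

import Mathlib

noncomputable section

/-! ### Half graphs -/

/-- The lower triangular 0-1 matrix: ones on and below the main diagonal. -/
def lowerTri (n : ℕ) : Matrix (Fin n) (Fin n) Bool :=
  fun i j => decide (j ≤ i)

/-- The bipartite adjacency matrices of half graphs on `[n] × [n]`: all matrices obtained from
`lowerTri n` by permuting its rows and its columns. -/
def halfGraphs (n : ℕ) : Set (Matrix (Fin n) (Fin n) Bool) :=
  {M | ∃ σ τ : Equiv.Perm (Fin n), M = (lowerTri n).submatrix σ τ}

/-- The positions of an `n × n` matrix; an edge query names one of them. -/
abbrev Cell (n : ℕ) : Type := Fin n × Fin n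

/-- A hidden matrix, read as the bit string indexed by its positions. -/
def bits {n : ℕ} (M : Matrix (Fin n) (Fin n) Bool) : Cell n → Bool :=
  fun z => M z.1 z.2

/-! ### Query algorithms -/

/-- The elementary steps that a kind of query algorithm may take on a hidden input `x : I → Bool`:
each step `o` costs `cost o` queries and returns `a : Ans o` with probability `law x o a`.
Only the two instances `randomized` and `quantum` below are used. -/
structure QueryModel (I : Type) where
  Op : Type
  Ans : Op → Type
  fintypeAns : ∀ o, Fintype (Ans o)
  cost : Op → ℕ
  law : (I → Bool) → (o : Op) → Ans o → ℝ

/-- Adaptive algorithms over a query model that output an element of `R`: finite-depth trees in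
which the continuation depends on the classical answer to the step just taken. -/
inductive Alg {I : Type} (Q : QueryModel I) (R : Type) : Type
  | ret (r : R) : Alg Q R
  | step (o : Q.Op) (k : Q.Ans o → Alg Q R) : Alg Q R

namespace Alg

variable {I : Type} {Q : QueryModel I}

/-- Sequential composition. -/
def bind {R S : Type} : Alg Q R → (R → Alg Q S) → Alg Q S
  | ret r, f => f r
  | step o k, f => step o (fun a => bind (k a) f)

instance : Monad (Alg Q) where
  pure := Alg.ret
  bind := Alg.bind

/-- A single step, returning its answer. -/
def op (o : Q.Op) : Alg Q (Q.Ans o) := step o ret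

open Classical in
/-- The probability that the output on input `x` satisfies `E`. -/
def prob {R : Type} (x : I → Bool) (E : R → Prop) : Alg Q R → ℝ
  | ret r => if E r then 1 else 0
  | step o k =>
      letI := Q.fintypeAns o
      ∑ a, Q.law x o a * prob x E (k a)

/-- The expected number of queries made on input `x`. -/
def expCost {R : Type} (x : I → Bool) : Alg Q R → ℝ
  | ret _ => 0
  | step o k =>
      letI := Q.fintypeAns o
      Q.cost o + ∑ a, Q.law x o a * expCost x (k a)

end Alg

/-! ### Randomized query algorithms -/

/-- Steps of a randomized decision tree: query an input bit, or make a uniformly random choice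
among `k + 1` alternatives. -/
inductive RandOp (I : Type) : Type
  | ask (i : I) : RandOp I
  | pick (k : ℕ) : RandOp I

/-- Answers to the steps of a randomized decision tree. -/
abbrev RandOp.Ans {I : Type} : RandOp I → Type
  | .ask _ => Bool
  | .pick k => Fin (k + 1)

/-- Randomized query algorithms: a query costs 1, a random choice costs nothing. -/
def randomized (I : Type) : QueryModel I where
  Op := RandOp I
  Ans := RandOp.Ans
  fintypeAns := fun o => match o with
    | .ask _ => inferInstanceAs (Fintype Bool)
    | .pick k => inferInstanceAs (Fintype (Fin (k + 1)))
  cost := fun o => match o with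
    | .ask _ => 1
    | .pick _ => 0
  law := fun x o => match o with
    | .ask i => fun b => if b = x i then 1 else 0
    | .pick k => fun _ => 1 / ((k : ℝ) + 1)

def randAsk {I : Type} (i : I) : Alg (randomized I) Bool :=
  Alg.op (Q := randomized I) (RandOp.ask i)

def randPick {I : Type} (k : ℕ) : Alg (randomized I) (Fin (k + 1)) :=
  Alg.op (Q := randomized I) (RandOp.pick k)

/-! ### Quantum query algorithms -/

/-- Labels of the computational basis: a query register `i`, an answer bit `b`, and a
`w`-dimensional work register. -/
abbrev QBasis (I : Type) (w : ℕ) : Type := I × Bool × Fin w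

/-- The query unitary `O_x : |i⟩|b⟩|a⟩ ↦ |i⟩|b + x_i⟩|a⟩`, acting on amplitude vectors. -/
def oracle {I : Type} {w : ℕ} (x : I → Bool) (ψ : QBasis I w → ℂ) : QBasis I w → ℂ :=
  fun z => ψ (z.1, xor z.2.1 (x z.1), z.2.2)

/-- A quantum query circuit `U_0, O_x, U_1, O_x, …, O_x, U_T` acting on a fixed unit vector; the
initial vector and the unitaries do not depend on the input. -/
structure QCircuit (I : Type) [Fintype I] [DecidableEq I] where
  w : ℕ
  init : QBasis I w → ℂ
  init_unit : ∑ z, ‖init z‖ ^ 2 = 1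
  T : ℕ
  U : ℕ → Matrix.unitaryGroup (QBasis I w) ℂ

namespace QCircuit

variable {I : Type} [Fintype I] [DecidableEq I]

/-- The state after `t` queries and the unitary that follows them. -/
def state (c : QCircuit I) (x : I → Bool) : ℕ → QBasis I c.w → ℂ
  | 0 => (c.U 0 : Matrix _ _ ℂ).mulVec c.init
  | t + 1 => (c.U (t + 1) : Matrix _ _ ℂ).mulVec (oracle x (c.state x t))

/-- The probability of observing `z` when the final state is measured in the computational
basis. -/
def measure (c : QCircuit I) (x : I → Bool) (z : QBasis I c.w) : ℝ :=
  ‖c.state x c.T z‖ ^ 2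

open Classical in
/-- The probability that the circuit, with the output computed from the observed basis label by
`out`, outputs `r`. -/
def outProb {R : Type} (c : QCircuit I) (out : QBasis I c.w → R) (x : I → Bool) (r : R) : ℝ :=
  ∑ z, if out z = r then c.measure x z else 0

end QCircuit

/-- Quantum query algorithms with intermediate measurements: a step runs a circuit of the
algorithm's choice and measures it; everything that follows may depend on the observed value. -/
def quantum (I : Type) [Fintype I] [DecidableEq I] : QueryModel I where
  Op := QCircuit I
  Ans := fun c => QBasis I c.w
  fintypeAns := fun _ => inferInstance
  cost := fun c => c.T
  law := fun x c z => c.measure x z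

/-- The circuit that makes one classical query to `i`. -/
def askCircuit {I : Type} [Fintype I] [DecidableEq I] (i : I) : QCircuit I where
  w := 1
  init := fun z => if z = (i, false, 0) then 1 else 0
  init_unit := by
    rw [Finset.sum_eq_single (i, false, (0 : Fin 1))]
    · simp
    · intro b _ hb
      simp [hb]
    · simp
  T := 1
  U := fun _ => 1

/-- The query-free circuit that measures a uniform superposition of `k + 1` work states. -/
def pickCircuit {I : Type} [Fintype I] [DecidableEq I] [Inhabited I] (k : ℕ) : QCircuit I where
  w := k + 1
  init := fun z =>
    if z.1 = default ∧ z.2.1 = false then ((1 / Real.sqrt ((k : ℝ) + 1) : ℝ) : ℂ) else 0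
  init_unit := by
    have hk : (0 : ℝ) < (k : ℝ) + 1 := by positivity
    have hs : ‖((1 / Real.sqrt ((k : ℝ) + 1) : ℝ) : ℂ)‖ ^ 2 = 1 / ((k : ℝ) + 1) := by
      rw [Complex.norm_real, Real.norm_eq_abs, sq_abs, div_pow, Real.sq_sqrt hk.le, one_pow]
    rw [Fintype.sum_prod_type, Finset.sum_eq_single (default : I)]
    · rw [Fintype.sum_prod_type, Fintype.sum_bool]
      simp only [hs, if_true, and_self, and_false, if_false, norm_zero, Bool.true_eq_false]
      simp
      field_simp
    · intro b _ hb
      simp [hb]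
    · simp
  T := 0
  U := fun _ => 1

def quantAsk {I : Type} [Fintype I] [DecidableEq I] (i : I) : Alg (quantum I) Bool :=
  Alg.step (Q := quantum I) (askCircuit i) (fun z : QBasis I 1 => Alg.ret z.2.1)

def quantPick {I : Type} [Fintype I] [DecidableEq I] [Inhabited I] (k : ℕ) :
    Alg (quantum I) (Fin (k + 1)) :=
  Alg.step (Q := quantum I) (pickCircuit k) (fun z : QBasis I (k + 1) => Alg.ret z.2.2)

/-! ### The quicksort-type learning algorithm

The algorithm is the same in both models; it is built from three subroutines: `ask` queries one
matrix entry, `pick k` draws a uniform element of `Fin (k + 1)`, and `search S p` looks for a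
position `z ∈ S` whose entry differs from the known bit `p z`. -/

section Quicksort

variable {n : ℕ} {Q : QueryModel (Cell n)}

/-- Query the entries of row `i` in the columns `cols`. -/
def queryRow (ask : Cell n → Alg Q Bool) (i : Fin n) : List (Fin n) → Alg Q (Fin n → Bool)
  | [] => pure (fun _ => false)
  | c :: cs => do
      let b ← ask (i, c)
      let p ← queryRow ask i cs
      pure (Function.update p c b)

/-- Compare each of the given rows with the pivot row `p` on the columns `cols`, by searching for
a column where they differ: a row that differs from the pivot at a 1 of the pivot is smaller,
a row that differs from it at a 0 of the pivot is larger. Returns the smaller and the larger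
rows. -/
def splitRows (search : Finset (Cell n) → (Cell n → Bool) → Alg Q (Cell n))
    (p : Fin n → Bool) (cols : List (Fin n)) :
    List (Fin n) → Alg Q (List (Fin n) × List (Fin n))
  | [] => pure ([], [])
  | j :: js => do
      let z ← search ({j} ×ˢ cols.toFinset) (fun z => p z.2)
      let r ← splitRows search p cols js
      pure (if p z.2 then (j :: r.1, r.2) else (r.1, j :: r.2))

/-- Randomized quicksort of a list of rows restricted to the columns `cols`. The first argument
bounds the recursion depth; it is never reached if it is at least the number of rows. -/
def quicksortRows (ask : Cell n → Alg Q Bool) (pick : (k : ℕ) → Alg Q (Fin (k + 1)))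
    (search : Finset (Cell n) → (Cell n → Bool) → Alg Q (Cell n)) :
    ℕ → List (Fin n) → List (Fin n) → Alg Q (List (Fin n))
  | 0, _, _ => pure []
  | _ + 1, [], _ => pure []
  | _ + 1, [r], _ => pure [r]
  | f + 1, r :: r' :: rs, cols => do
      let k ← pick (rs.length + 1)
      let p ← queryRow ask ((r :: r' :: rs).get k) cols
      let s ← splitRows search p cols ((r :: r' :: rs).eraseIdx k)
      let a ← quicksortRows ask pick search f s.1 (cols.filter (fun c => p c))
      let b ← quicksortRows ask pick search f s.2 (cols.filter (fun c => !p c))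
      pure (a ++ (r :: r' :: rs).get k :: b)

/-- Sort the rows, sort the columns by the same procedure on the transposed matrix, and output the
matrix in which the row and the column at positions `a` and `b` of the two increasing orders
(counted from 0) meet in a 1 if and only if `n ≤ a + b + 1`. -/
def quicksortLearner (ask : Cell n → Alg Q Bool) (pick : (k : ℕ) → Alg Q (Fin (k + 1)))
    (search : Finset (Cell n) → (Cell n → Bool) → Alg Q (Cell n)) :
    Alg Q (Matrix (Fin n) (Fin n) Bool) := do
  let R ← quicksortRows ask pick search n (List.finRange n) (List.finRange n)
  let K ← quicksortRows (fun z => ask z.swap) pick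
    (fun S p => do
      let z ← search (S.image Prod.swap) (fun z => p z.swap)
      pure z.swap)
    n (List.finRange n) (List.finRange n)
  pure (fun i j => decide (n ≤ R.idxOf i + K.idxOf j + 1))

end Quicksort

/-! ### Specifications -/

/-- `search S p` always finds a position of `S` at which the input differs from `p`, if there is
one; if there are `d` of them, it makes at most `bound |S| d` queries in expectation. -/
def IsSearch {I : Type} {Q : QueryModel I} (search : Finset I → (I → Bool) → Alg Q I)
    (bound : ℝ → ℝ → ℝ) : Prop :=
  ∀ (x : I → Bool) (S : Finset I) (p : I → Bool), (∃ i ∈ S, x i ≠ p i) →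
    (search S p).prob x (fun i => i ∈ S ∧ x i ≠ p i) = 1 ∧
    (search S p).expCost x ≤ bound S.card {i ∈ S | x i ≠ p i}.card

/-- The algorithm outputs the hidden matrix with probability 1, on every matrix of the class, and
makes at most `B` queries in expectation. -/
def LearnsInExpectation {n : ℕ} {Q : QueryModel (Cell n)}
    (A : Alg Q (Matrix (Fin n) (Fin n) Bool)) (F : Set (Matrix (Fin n) (Fin n) Bool))
    (B : ℝ) : Prop :=
  ∀ M ∈ F, A.prob (bits M) (fun N => N = M) = 1 ∧ A.expCost (bits M) ≤ B

/-- The circuit learns the class with error at most 1/3: on every hidden matrix of the class the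
output is that matrix with probability at least 2/3. -/
def LearnsWithBoundedError {n : ℕ} (c : QCircuit (Cell n))
    (out : QBasis (Cell n) c.w → Matrix (Fin n) (Fin n) Bool)
    (F : Set (Matrix (Fin n) (Fin n) Bool)) : Prop :=
  ∀ M ∈ F, 2 / 3 ≤ c.outProb out (bits M) M

end

/-! Upper bounds. In the matrix with entries `τ c ≤ σ i`, two rows of ranks `u` and `v` differ in
exactly `|u - v|` columns, those whose rank separates them. A recursive call of quicksort sees `m`
rows of consecutive ranks, at most `m + 1` columns, and all columns separating these rows. So
comparing the pivot with a row at rank distance `d` is a search with `d` marked positions among at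
most `m + 1`, and each distance occurs at most twice. A search cost of order `s / d` gives a
harmonic sum, hence `O(m log n)` per pivot; a cost of order `√(s / d)` gives `O(m)`. The recurrence
`T m = D m + (2 / m) ∑_{k < m} T k` of quicksort then yields `O(D n log n)`
(`QuicksortSpec.quicksortRows_meets`, `sum_harmonic_le`).

The randomized search samples without replacement. The quantum search runs Grover iterations a
random number of times, with a range growing geometrically because the number of marked positions is
unknown. Every observed position is checked by a query, and a classical scan follows if all rounds
fail, so the answer is never wrong (`quantSearch_isSearch`).

Lower bound. The comparison matrices of orders `σ` are half graphs. An adversary pairs `σ` with the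
order obtained by moving the element of rank `m` down to rank `k`, with weight `1 / (m - k)`, and
follows the weighted sum of the inner products of the two states. It starts at `n!` times a sum of
inverse distances, which is at least `(n / 2) log n`, and must end smaller by a constant factor. A
query affects a pair only through comparisons of the moved element with those it passes. After
balancing the two states by Cauchy–Schwarz weights, the loss per query is governed by a Hilbert-type
kernel `1 / (P + q)`, whose boundedness (`schur_test`) limits the loss to `O(n!)`. Hence order `n
log n` queries are needed. -/

noncomputable section

/-! ### Sure events and expected cost of adaptive algorithms -/

namespace Alg

variable {I : Type} {Q : QueryModel I} {R S : Type}

@[simp] theorem pure_eq (r : R) : (pure r : Alg Q R) = ret r := rfl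

@[simp] theorem ret_bind (r : R) (f : R → Alg Q S) : (ret r : Alg Q R) >>= f = f r := rfl

@[simp] theorem step_bind (o : Q.Op) (k : Q.Ans o → Alg Q R) (f : R → Alg Q S) :
    (step o k : Alg Q R) >>= f = step o (fun a => k a >>= f) := rfl

/-- Every outcome reached with nonzero probability on input `x` satisfies `E`. -/
def Sure (x : I → Bool) (E : R → Prop) : Alg Q R → Prop
  | ret r => E r
  | step o k => ∀ a, Q.law x o a ≠ 0 → Sure x E (k a)

theorem Sure.mono {x : I → Bool} {E E' : R → Prop} (h : ∀ r, E r → E' r) :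
    ∀ {A : Alg Q R}, A.Sure x E → A.Sure x E'
  | ret _, hA => h _ hA
  | step _ _, hA => fun a ha => (hA a ha).mono h

theorem Sure.bind {x : I → Bool} {E : R → Prop} {E' : S → Prop} {f : R → Alg Q S}
    (hf : ∀ r, E r → (f r).Sure x E') : ∀ {A : Alg Q R}, A.Sure x E → (A >>= f).Sure x E'
  | ret _, hA => hf _ hA
  | step _ _, hA => fun a ha => (hA a ha).bind hf

end Alg

/-- On input `x` the answers to each step follow a probability distribution. -/
structure QueryModel.IsProb {I : Type} (Q : QueryModel I) (x : I → Bool) : Prop where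
  law_nonneg : ∀ o a, 0 ≤ Q.law x o a
  sum_law : ∀ o, (letI := Q.fintypeAns o; ∑ a, Q.law x o a) = 1

namespace Alg

variable {I : Type} {Q : QueryModel I} {R S : Type} {x : I → Bool}

theorem prob_mem (hQ : Q.IsProb x) (E : R → Prop) :
    ∀ A : Alg Q R, 0 ≤ A.prob x E ∧ A.prob x E ≤ 1
  | ret r => by
      unfold prob
      split_ifs <;> simp
  | step o k => by
      let := Q.fintypeAns o
      have ih := fun a => prob_mem hQ E (k a)
      simp only [prob]
      refine ⟨Finset.sum_nonneg fun a _ => mul_nonneg (hQ.law_nonneg o a) (ih a).1, ?_⟩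
      calc ∑ a, Q.law x o a * prob x E (k a) ≤ ∑ a, Q.law x o a :=
            Finset.sum_le_sum fun a _ =>
              mul_le_of_le_one_right (hQ.law_nonneg o a) (ih a).2
        _ = 1 := hQ.sum_law o

/-- An average of numbers at most 1 equals 1 only if every number of nonzero weight is 1. This
replaces probability statements by `Sure`, which composes under `bind` without arithmetic. -/
theorem prob_eq_one_iff (hQ : Q.IsProb x) (E : R → Prop) :
    ∀ A : Alg Q R, A.prob x E = 1 ↔ A.Sure x E
  | ret r => by
      simp only [prob, Sure]
      split_ifs with h <;> simp [h]
  | step o k => by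
      let := Q.fintypeAns o
      have ih := fun a => prob_eq_one_iff hQ E (k a)
      simp only [prob, Sure]
      have key : ∑ a, Q.law x o a * (1 - prob x E (k a)) =
          1 - ∑ a, Q.law x o a * prob x E (k a) := by
        simp only [mul_sub, mul_one, Finset.sum_sub_distrib, hQ.sum_law o]
      have hz := Finset.sum_eq_zero_iff_of_nonneg (s := Finset.univ)
        (f := fun a => Q.law x o a * (1 - prob x E (k a)))
        fun a _ => mul_nonneg (hQ.law_nonneg o a) (sub_nonneg.2 (prob_mem hQ E (k a)).2)
      rw [← sub_eq_zero, ← neg_eq_zero, neg_sub, ← key, hz]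
      simp only [Finset.mem_univ, true_implies, mul_eq_zero]
      refine forall_congr' fun a => ?_
      rw [← ih a]
      constructor
      · intro h ha
        linarith [h.resolve_left ha]
      · intro h
        by_cases ha : Q.law x o a = 0
        · exact Or.inl ha
        · exact Or.inr (by rw [h ha]; ring)

theorem expCost_nonneg (hQ : Q.IsProb x) : ∀ A : Alg Q R, 0 ≤ A.expCost x
  | ret _ => le_rfl
  | step o k => by
      let := Q.fintypeAns o
      exact add_nonneg (Nat.cast_nonneg _) <| Finset.sum_nonneg fun a _ =>
        mul_nonneg (hQ.law_nonneg o a) (expCost_nonneg hQ (k a))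

/-- Outcomes of probability zero contribute nothing, so the continuation has to be bounded only on
the outcomes that `Sure` allows. -/
theorem expCost_bind_le (hQ : Q.IsProb x) {E : R → Prop} {f : R → Alg Q S} {B : ℝ}
    (hf : ∀ r, E r → (f r).expCost x ≤ B) :
    ∀ {A : Alg Q R}, A.Sure x E → (A >>= f).expCost x ≤ A.expCost x + B
  | ret _, hA => by simpa [expCost] using hf _ hA
  | step o k, hA => by
      let := Q.fintypeAns o
      rw [step_bind]
      simp only [expCost]
      have : ∑ a, Q.law x o a * expCost x (k a >>= f) ≤
          ∑ a, (Q.law x o a * expCost x (k a) + Q.law x o a * B) := by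
        refine Finset.sum_le_sum fun a _ => ?_
        rw [← mul_add]
        by_cases ha : Q.law x o a = 0
        · simp [ha]
        · exact mul_le_mul_of_nonneg_left (expCost_bind_le hQ hf (hA a ha)) (hQ.law_nonneg o a)
      rw [Finset.sum_add_distrib, ← Finset.sum_mul, hQ.sum_law o] at this
      linarith

/-- On input `x` the output surely satisfies `E`, at expected cost at most `B`. -/
def Meets (x : I → Bool) (A : Alg Q R) (E : R → Prop) (B : ℝ) : Prop :=
  A.Sure x E ∧ A.expCost x ≤ B

theorem meets_ret {r : R} {E : R → Prop} {B : ℝ} (h : E r) (hB : 0 ≤ B) :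
    (ret r : Alg Q R).Meets x E B := ⟨h, hB⟩

theorem Meets.bind (hQ : Q.IsProb x) {A : Alg Q R} {E : R → Prop} {f : R → Alg Q S}
    {E' : S → Prop} {B B' C : ℝ} (hA : A.Meets x E B) (hf : ∀ r, E r → (f r).Meets x E' B')
    (hC : B + B' ≤ C) : (A >>= f).Meets x E' C :=
  ⟨hA.1.bind fun r hr => (hf r hr).1,
    (expCost_bind_le hQ (fun r hr => (hf r hr).2) hA.1).trans (by linarith [hA.2])⟩

theorem Meets.prob_eq_one (hQ : Q.IsProb x) {A : Alg Q R} {E : R → Prop} {B : ℝ}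
    (h : A.Meets x E B) : A.prob x E = 1 := (prob_eq_one_iff hQ E A).2 h.1

end Alg

/-! ### The randomized model -/

namespace randomized

variable {I : Type} {R : Type} (x : I → Bool)

theorem isProb : (randomized I).IsProb x where
  law_nonneg o a := by
    rcases o with i | k
    · have h (b : Bool) : (0 : ℝ) ≤ if b = x i then 1 else 0 := by split_ifs <;> norm_num
      exact h a
    · show (0 : ℝ) ≤ 1 / ((k : ℝ) + 1)
      positivity
  sum_law o := by
    rcases o with i | k
    · show ∑ b : Bool, (if b = x i then (1 : ℝ) else 0) = 1
      simp
    · show ∑ _ : Fin (k + 1), 1 / ((k : ℝ) + 1) = 1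
      rw [Finset.sum_const, Finset.card_univ, Fintype.card_fin, nsmul_eq_mul]
      push_cast
      field_simp

theorem expCost_ask_bind (i : I) (f : Bool → Alg (randomized I) R) :
    (randAsk i >>= f).expCost x = 1 + (f (x i)).expCost x := by
  show ((1 : ℕ) : ℝ) + ∑ b : Bool, (if b = x i then (1 : ℝ) else 0) * (f b).expCost x = _
  simp

theorem expCost_pick_bind (k : ℕ) (f : Fin (k + 1) → Alg (randomized I) R) :
    (randPick k >>= f).expCost x = (∑ j, (f j).expCost x) / (k + 1) := by
  show ((0 : ℕ) : ℝ) + ∑ j : Fin (k + 1), 1 / ((k : ℝ) + 1) * (f j).expCost x = _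
  rw [← Finset.mul_sum]
  push_cast
  ring

theorem sure_ask (i : I) : (randAsk i).Sure x (· = x i) := by
  intro b hb
  by_contra h
  exact hb (if_neg h)

theorem meets_ask (i : I) : (randAsk i).Meets x (· = x i) 1 :=
  ⟨sure_ask x i, by
    show ((1 : ℕ) : ℝ) + ∑ b : Bool, (if b = x i then (1 : ℝ) else 0) * 0 ≤ 1
    simp⟩

theorem sure_pick (k : ℕ) : (randPick (I := I) k).Sure x (fun _ => True) :=
  fun _ _ => trivial

end randomized

/-! ### The quantum model -/

section Unitary

variable {ι : Type} [Fintype ι]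

theorem star_dotProduct_unitary [DecidableEq ι] (U : Matrix.unitaryGroup ι ℂ) (φ ψ : ι → ℂ) :
    star ((U : Matrix ι ι ℂ).mulVec φ) ⬝ᵥ (U : Matrix ι ι ℂ).mulVec ψ = star φ ⬝ᵥ ψ := by
  rw [Matrix.star_mulVec, Matrix.dotProduct_mulVec, Matrix.vecMul_vecMul,
    ← Matrix.star_eq_conjTranspose, Matrix.UnitaryGroup.star_mul_self, Matrix.vecMul_one]

theorem sum_norm_sq_eq_star_dotProduct (φ : ι → ℂ) :
    ((∑ z, ‖φ z‖ ^ 2 : ℝ) : ℂ) = star φ ⬝ᵥ φ := by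
  simp only [dotProduct, Complex.ofReal_sum, Pi.star_apply]
  refine Finset.sum_congr rfl fun z _ => ?_
  rw [Complex.ofReal_pow, ← Complex.conj_mul', starRingEnd_apply]

end Unitary

section Oracle

variable {I : Type} {w : ℕ}

/-- The permutation of the basis labels underlying a query. -/
def oracleEquiv (x : I → Bool) : Equiv.Perm (QBasis I w) where
  toFun z := (z.1, xor z.2.1 (x z.1), z.2.2)
  invFun z := (z.1, xor z.2.1 (x z.1), z.2.2)
  left_inv z := by simp
  right_inv z := by simp

theorem oracle_apply (x : I → Bool) (ψ : QBasis I w → ℂ) (z : QBasis I w) :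
    oracle x ψ z = ψ (oracleEquiv x z) := rfl

end Oracle

namespace QCircuit

variable {I : Type} [Fintype I] [DecidableEq I] (c : QCircuit I) (x : I → Bool)

theorem sum_norm_sq_state : ∀ t, ∑ z, ‖c.state x t z‖ ^ 2 = 1
  | 0 => by
      have h := c.init_unit
      rw [← Complex.ofReal_inj] at h ⊢
      rw [sum_norm_sq_eq_star_dotProduct] at h ⊢
      rw [state, star_dotProduct_unitary, h]
  | t + 1 => by
      have h := sum_norm_sq_state t
      rw [← Equiv.sum_comp (oracleEquiv x)] at h
      simp only [← oracle_apply x (c.state x t)] at h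
      rw [← Complex.ofReal_inj] at h ⊢
      rw [sum_norm_sq_eq_star_dotProduct] at h ⊢
      rw [state, star_dotProduct_unitary, h]

theorem state_zero_of_eq_one (h : c.U 0 = 1) : c.state x 0 = c.init := by
  rw [state, h, OneMemClass.coe_one, Matrix.one_mulVec]

theorem state_succ_of_eq_one {t : ℕ} (h : c.U (t + 1) = 1) :
    c.state x (t + 1) = oracle x (c.state x t) := by
  rw [state, h, OneMemClass.coe_one, Matrix.one_mulVec]

theorem measure_nonneg (z : QBasis I c.w) : 0 ≤ c.measure x z := by
  unfold measure
  positivity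

theorem sum_measure : ∑ z, c.measure x z = 1 := c.sum_norm_sq_state x c.T

end QCircuit

namespace quantum

variable {I : Type} [Fintype I] [DecidableEq I] {R : Type} (x : I → Bool)

theorem isProb : (quantum I).IsProb x where
  law_nonneg c z := c.measure_nonneg x z
  sum_law c := c.sum_measure x

theorem askCircuit_measure (i : I) (z : QBasis I 1) :
    (askCircuit i).measure x z = if z = (i, x i, 0) then 1 else 0 := by
  have : (askCircuit i).state x 1 z = if z = (i, x i, 0) then 1 else 0 := by
    rw [QCircuit.state_succ_of_eq_one _ _ rfl, QCircuit.state_zero_of_eq_one _ _ rfl]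
    show (if ((z.1, xor z.2.1 (x z.1), z.2.2) : QBasis I 1) = (i, false, 0) then (1 : ℂ) else 0) = _
    obtain ⟨j, b, a⟩ := z
    refine if_congr ?_ rfl rfl
    simp only [Prod.mk.injEq]
    refine and_congr_right fun h => and_congr_left fun _ => ?_
    subst h
    cases b <;> cases x j <;> simp
  show ‖(askCircuit i).state x 1 z‖ ^ 2 = _
  rw [this]
  split_ifs <;> simp

theorem pickCircuit_measure [Inhabited I] (k : ℕ) (z : QBasis I (k + 1)) :
    (pickCircuit (I := I) k).measure x z =
      if z.1 = default ∧ z.2.1 = false then 1 / ((k : ℝ) + 1) else 0 := by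
  have : (pickCircuit (I := I) k).state x 0 z =
      if z.1 = default ∧ z.2.1 = false then ((1 / Real.sqrt ((k : ℝ) + 1) : ℝ) : ℂ) else 0 := by
    rw [QCircuit.state_zero_of_eq_one _ _ rfl]
    rfl
  show ‖(pickCircuit (I := I) k).state x 0 z‖ ^ 2 = _
  have hk : (0 : ℝ) < (k : ℝ) + 1 := by positivity
  rw [this]
  split_ifs
  · rw [Complex.norm_real, Real.norm_eq_abs, sq_abs, div_pow, Real.sq_sqrt hk.le, one_pow]
  · simp

theorem expCost_ask_bind (i : I) (f : Bool → Alg (quantum I) R) :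
    (quantAsk i >>= f).expCost x = 1 + (f (x i)).expCost x := by
  show ((1 : ℕ) : ℝ) + ∑ z : QBasis I 1, (askCircuit i).measure x z * (f z.2.1).expCost x = _
  simp only [askCircuit_measure]
  simp

theorem expCost_pick_bind [Inhabited I] (k : ℕ) (f : Fin (k + 1) → Alg (quantum I) R) :
    (quantPick k >>= f).expCost x = (∑ j, (f j).expCost x) / (k + 1) := by
  show ((0 : ℕ) : ℝ) + ∑ z : QBasis I (k + 1),
    (pickCircuit (I := I) k).measure x z * (f z.2.2).expCost x = _
  simp only [pickCircuit_measure]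
  rw [Fintype.sum_prod_type, Finset.sum_eq_single (default : I)]
  · rw [Fintype.sum_prod_type, Fintype.sum_bool]
    simp only [and_true, and_false, if_false, if_true, Bool.true_eq_false, zero_mul,
      Finset.sum_const_zero, ← Finset.mul_sum]
    push_cast
    ring
  · intro b _ hb
    simp [hb]
  · simp

theorem sure_ask (i : I) : (quantAsk i).Sure x (· = x i) := by
  intro (z : QBasis I 1) hz
  show z.2.1 = x i
  have h : (askCircuit i).measure x z ≠ 0 := hz
  rw [askCircuit_measure] at h
  by_contra hne
  exact h (if_neg fun hzi => hne (by rw [hzi]))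

theorem meets_ask (i : I) : (quantAsk i).Meets x (· = x i) 1 :=
  ⟨sure_ask x i, by
    show ((1 : ℕ) : ℝ) + ∑ z : QBasis I 1, (askCircuit i).measure x z * 0 ≤ 1
    simp⟩

theorem sure_pick [Inhabited I] (k : ℕ) : (quantPick (I := I) k).Sure x (fun _ => True) :=
  fun _ _ => trivial

end quantum

/-! ### Classical search by sampling without replacement -/

section RandomizedSearch

variable {I : Type}

/-- Sample the positions of a list without replacement, until one is found at which the input
differs from `p`. The first argument bounds the number of samples. -/
def sampleSearch [Inhabited I] (p : I → Bool) : ℕ → List I → Alg (randomized I) I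
  | 0, _ => pure default
  | _ + 1, [] => pure default
  | f + 1, i :: is => do
      let k ← randPick is.length
      let b ← randAsk ((i :: is).get k)
      if b ≠ p ((i :: is).get k) then pure ((i :: is).get k)
      else sampleSearch p f ((i :: is).eraseIdx k)

variable [Inhabited I] (x p : I → Bool)

theorem sampleSearch_sure : ∀ (f : ℕ) (l : List I), l.length ≤ f → (∃ i ∈ l, x i ≠ p i) →
    (sampleSearch p f l).Sure x (fun i => i ∈ l ∧ x i ≠ p i)
  | 0, l, hl, ⟨i, hi, _⟩ => by simp_all
  | f + 1, [], _, ⟨i, hi, _⟩ => by simp_all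
  | f + 1, i :: is, hl, hd => by
      rw [sampleSearch]
      refine (randomized.sure_pick x _).bind fun k _ => (randomized.sure_ask x _).bind ?_
      rintro _ rfl
      dsimp only
      split_ifs with h
      · exact ⟨List.get_mem _ _, h⟩
      · refine (sampleSearch_sure f _ ?_ ?_).mono fun j hj => ⟨List.mem_of_mem_eraseIdx hj.1, hj.2⟩
        · have := List.length_eraseIdx_of_lt (l := i :: is) (i := k) k.2
          simp only [List.length_cons] at this hl
          omega
        · obtain ⟨j, hj, hne⟩ := hd
          have hp := List.getElem_cons_eraseIdx_perm (l := i :: is) (n := k) k.2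
          rcases List.mem_cons.1 (hp.mem_iff.2 hj) with rfl | hj'
          · exact absurd hne h
          · exact ⟨j, hj', hne⟩

theorem sum_fin_get {α : Type} (l : List α) (g : α → ℝ) :
    ∑ k : Fin l.length, g (l.get k) = (l.map g).sum := by
  rw [← List.sum_ofFn, show (fun k => g (l.get k)) = g ∘ l.get from rfl, ← List.map_ofFn,
    List.ofFn_get]

theorem sum_map_ite {α : Type} (l : List α) (P : α → Prop) [DecidablePred P] :
    (l.map fun i => if P i then (1 : ℝ) else 0).sum = l.countP (fun i => P i) := by
  induction l with
  | nil => simp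
  | cons a l ih =>
    rw [List.map_cons, List.sum_cons, List.countP_cons, ih]
    by_cases h : P a <;> simp [h, add_comm]

/-- With `s` positions, `d` of them marked, a sample misses with probability `(s - d) / s` and
leaves `s - 1` positions with `d` marked, so induction gives `1 + ((s - d) / s) * (s / (d + 1)) = (s
+ 1) / (d + 1)`. -/
theorem sampleSearch_cost : ∀ (f : ℕ) (l : List I),
    (sampleSearch p f l).expCost x ≤ (l.length + 1) / (l.countP (fun i => x i ≠ p i) + 1)
  | 0, l => by
      show (0 : ℝ) ≤ _
      positivity
  | f + 1, [] => by
      show (0 : ℝ) ≤ _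
      positivity
  | f + 1, i :: is => by
      rw [sampleSearch, randomized.expCost_pick_bind]
      simp only [randomized.expCost_ask_bind]
      set l := i :: is with hl
      have hlen : (l.length : ℝ) = is.length + 1 := by simp [hl]
      set d := l.countP (fun i => x i ≠ p i) with hd
      have hterm (k : Fin l.length) :
          1 + (if x (l.get k) ≠ p (l.get k) then pure (l.get k)
            else sampleSearch p f (l.eraseIdx k)).expCost x ≤
          1 + (l.length / (d + 1) - (if x (l.get k) ≠ p (l.get k) then 1 else 0) *
            (l.length / (d + 1)) : ℝ) := by
        gcongr
        split_ifs with h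
        · show (0 : ℝ) ≤ _
          simp
        · refine (sampleSearch_cost f _).trans ?_
          have hp := List.getElem_cons_eraseIdx_perm (l := l) (n := k) k.2
          have h1 : (l.eraseIdx k).countP (fun i => x i ≠ p i) = d := by
            rw [hd, ← hp.countP_eq, List.countP_cons_of_neg]
            simpa using h
          have h2 : (l.eraseIdx k).length + 1 = l.length := by
            simpa using hp.length_eq
          have h3 : ((l.eraseIdx k).length : ℝ) + 1 = l.length := by exact_mod_cast h2
          rw [h1, h3]
          linarith
      have hcount : ((l.map fun i => if x i ≠ p i then (1 : ℝ) else 0).sum) = d := by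
        rw [hd]
        exact sum_map_ite l _
      rw [div_le_iff₀ (by positivity)]
      refine (Finset.sum_le_sum fun k _ => hterm k).trans ?_
      rw [Finset.sum_add_distrib, Finset.sum_sub_distrib, ← Finset.sum_mul,
        sum_fin_get l (fun i => if x i ≠ p i then (1 : ℝ) else 0), hcount]
      simp only [Finset.sum_const, Finset.card_univ, Fintype.card_fin, nsmul_eq_mul]
      rw [← hlen]
      field_simp
      rw [show ((i :: is).length : ℝ) = l.length from rfl]
      exact le_of_eq (by ring)

/-- Sample the positions of `S` without replacement. -/
def randSearch (S : Finset I) (p : I → Bool) : Alg (randomized I) I :=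
  sampleSearch p S.toList.length S.toList

theorem randSearch_isSearch :
    IsSearch (randSearch (I := I)) (fun s d => s / d) := by
  intro x S p hS
  have hS' : ∃ i ∈ S.toList, x i ≠ p i := by simpa using hS
  refine ⟨(Alg.prob_eq_one_iff (randomized.isProb x) _ _).2
    ((sampleSearch_sure x p _ _ le_rfl hS').mono fun i hi => by simpa using hi), ?_⟩
  refine (sampleSearch_cost x p _ _).trans ?_
  have hc : S.toList.countP (fun i => x i ≠ p i) = {i ∈ S | x i ≠ p i}.card := by
    rw [Finset.card_def, Finset.filter_val, ← Multiset.countP_eq_card_filter,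
      ← Finset.coe_toList S, Multiset.coe_countP]
  have hd : 0 < {i ∈ S | x i ≠ p i}.card := by
    obtain ⟨i, hi⟩ := hS
    exact Finset.card_pos.2 ⟨i, by simpa using hi⟩
  have hle : {i ∈ S | x i ≠ p i}.card ≤ S.card := Finset.card_filter_le _ _
  rw [hc, Finset.length_toList]
  -- `(s + 1) / (d + 1) ≤ s / d` amounts to `d ≤ s`.
  rw [div_le_div_iff₀ (by positivity) (by positivity)]
  have : ({i ∈ S | x i ≠ p i}.card : ℝ) ≤ S.card := by exact_mod_cast hle
  linarith

end RandomizedSearch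

/-! ### Grover iterations -/

section Grover

open scoped Kronecker
open Matrix

variable {I : Type} [DecidableEq I]

/-- The sign `(-1)^b`. -/
def boolSign (b : Bool) : ℂ := if b then -1 else 1

/-- The indicator vector of a set of positions. -/
def indicatorVec (S : Finset I) : I → ℂ := fun i => if i ∈ S then 1 else 0

theorem star_indicatorVec (S : Finset I) : star (indicatorVec S) = indicatorVec S := by
  ext i
  simp only [Pi.star_apply, indicatorVec]
  split_ifs <;> simp

variable [Fintype I]

theorem indicatorVec_dotProduct (S : Finset I) (φ : I → ℂ) :
    indicatorVec S ⬝ᵥ φ = ∑ i ∈ S, φ i := by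
  simp [indicatorVec, dotProduct, Finset.sum_ite_mem]

/-- The reflection about the uniform superposition of the positions in `S`. -/
def uniformReflection (S : Finset I) : Matrix I I ℂ :=
  (2 / S.card : ℂ) • vecMulVec (indicatorVec S) (indicatorVec S) - 1

theorem uniformReflection_mul_self {S : Finset I} (hS : S.Nonempty) :
    uniformReflection S * uniformReflection S = 1 := by
  have hs : (S.card : ℂ) ≠ 0 := by exact_mod_cast hS.card_pos.ne'
  have hv : indicatorVec S ⬝ᵥ indicatorVec S = S.card := by
    rw [indicatorVec_dotProduct]
    simp [indicatorVec]
  have hV : vecMulVec (indicatorVec S) (indicatorVec S) *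
      vecMulVec (indicatorVec S) (indicatorVec S) =
      (S.card : ℂ) • vecMulVec (indicatorVec S) (indicatorVec S) := by
    rw [vecMulVec_mul_vecMulVec, hv]
    ext i j
    simp [vecMulVec_apply]
    ring
  rw [uniformReflection, sub_mul, mul_sub, mul_sub, smul_mul_smul_comm, hV, smul_smul]
  simp only [mul_one, one_mul]
  rw [show (2 / (S.card : ℂ) * (2 / S.card) * S.card) = 2 / S.card + 2 / S.card by
    field_simp; norm_num, add_smul]
  abel

theorem uniformReflection_mem {S : Finset I} (hS : S.Nonempty) :
    uniformReflection S ∈ unitaryGroup I ℂ := by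
  have hst : star (uniformReflection S) = uniformReflection S := by
    rw [star_eq_conjTranspose, uniformReflection, conjTranspose_sub, conjTranspose_smul,
      conjTranspose_vecMulVec, star_indicatorVec, conjTranspose_one]
    simp
  rw [mem_unitaryGroup_iff, hst, uniformReflection_mul_self hS]

theorem boolSign_phase_mem (p : I → Bool) :
    diagonal (fun i => boolSign (p i)) ∈ unitaryGroup I ℂ := by
  rw [mem_unitaryGroup_iff, star_eq_conjTranspose, diagonal_conjTranspose, diagonal_mul_diagonal,
    ← diagonal_one]
  congr 1
  ext i
  simp only [boolSign, Pi.star_apply]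
  split_ifs <;> simp

/-- The unitary following a query in a Grover iteration: undo the phase of the known string `p`,
then reflect about the uniform superposition of `S`. -/
def groverStep {S : Finset I} (hS : S.Nonempty) (p : I → Bool) :
    unitaryGroup (QBasis I 1) ℂ :=
  ⟨(uniformReflection S * diagonal (fun i => boolSign (p i))) ⊗ₖ (1 : Matrix (Bool × Fin 1) _ ℂ),
    kronecker_mem_unitary (mul_mem (uniformReflection_mem hS) (boolSign_phase_mem p))
      (one_mem _)⟩

theorem groverStep_mulVec {S : Finset I} (hS : S.Nonempty) (p : I → Bool)
    (φ : QBasis I 1 → ℂ) (z : QBasis I 1) :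
    ((groverStep hS p : unitaryGroup (QBasis I 1) ℂ) : Matrix _ _ ℂ).mulVec φ z =
      (if z.1 ∈ S then 2 / S.card * ∑ i ∈ S, boolSign (p i) * φ (i, z.2) else 0) -
        boolSign (p z.1) * φ z := by
  have h1 : ((groverStep hS p : unitaryGroup (QBasis I 1) ℂ) : Matrix _ _ ℂ).mulVec φ z =
      (uniformReflection S * diagonal (fun i => boolSign (p i))).mulVec
        (fun i => φ (i, z.2)) z.1 := by
    simp only [groverStep, mulVec, dotProduct, kroneckerMap_apply]
    rw [Fintype.sum_prod_type]
    refine Finset.sum_congr rfl fun i _ => ?_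
    rw [Finset.sum_eq_single z.2]
    · simp
    · intro b _ hb
      simp [one_apply_ne hb.symm]
    · simp
  rw [h1, ← mulVec_mulVec, uniformReflection, sub_mulVec, smul_mulVec, vecMulVec_mulVec,
    indicatorVec_dotProduct, one_mulVec]
  simp only [Pi.sub_apply, Pi.smul_apply, mulVec_diagonal, indicatorVec]
  split_ifs <;> simp

/-- The circuit making `t` Grover iterations for the positions of `S` at which the input differs
from `p`. -/
def groverCircuit {S : Finset I} (hS : S.Nonempty) (p : I → Bool) (t : ℕ) : QCircuit I where
  w := 1
  init := fun z =>
    if z.1 ∈ S then boolSign z.2.1 * ((1 / Real.sqrt (2 * S.card) : ℝ) : ℂ) else 0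
  init_unit := by
    have hs : (0 : ℝ) < S.card := by exact_mod_cast hS.card_pos
    have h (b : Bool) : ‖boolSign b * ((1 / Real.sqrt (2 * S.card) : ℝ) : ℂ)‖ ^ 2 =
        1 / (2 * S.card) := by
      rw [norm_mul, Complex.norm_real, Real.norm_eq_abs, mul_pow, sq_abs, div_pow,
        Real.sq_sqrt (by positivity)]
      cases b <;> simp [boolSign]
    rw [Fintype.sum_prod_type]
    simp only [Fintype.sum_prod_type, Fintype.sum_bool, Finset.univ_unique, Finset.sum_singleton]
    have h2 (i : I) (b : Bool) :
        ‖if i ∈ S then boolSign b * ((1 / Real.sqrt (2 * S.card) : ℝ) : ℂ) else 0‖ ^ 2 =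
        if i ∈ S then (1 / (2 * S.card) : ℝ) else 0 := by
      split_ifs
      · exact h b
      · simp
    simp only [h2, Finset.sum_add_distrib, Finset.sum_ite_mem, Finset.univ_inter,
      Finset.sum_const, nsmul_eq_mul]
    field_simp
    norm_num
  T := t
  U := fun k => if k = 0 then 1 else groverStep hS p

/-- The amplitudes of the unmarked and of the marked positions after `t` Grover iterations, when
`d` out of `s` positions are marked. -/
def groverAmp (s d : ℝ) : ℕ → ℝ × ℝ
  | 0 => (1 / Real.sqrt (2 * s), 1 / Real.sqrt (2 * s))
  | t + 1 =>
      let v := groverAmp s d t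
      let m := 2 * ((s - d) * v.1 - d * v.2) / s
      (m - v.1, m + v.2)

/-- The answer register stays in the state proportional to `|0⟩ - |1⟩`, so a query acts as the phase
`(-1)^(x i)`. Together with the phase of `p` it flips the sign exactly at the marked positions, and
the reflection preserves vectors that are constant on the marked and on the unmarked positions. -/
theorem groverCircuit_state {S : Finset I} (hS : S.Nonempty) (p : I → Bool) (T : ℕ)
    (x : I → Bool) : ∀ (t : ℕ) (z : QBasis I 1),
    (groverCircuit hS p T).state x t z =
      if z.1 ∈ S then boolSign z.2.1 *
        ((if x z.1 ≠ p z.1 then (groverAmp S.card {i ∈ S | x i ≠ p i}.card t).2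
          else (groverAmp S.card {i ∈ S | x i ≠ p i}.card t).1 : ℝ) : ℂ) else 0
  | 0, z => by
      rw [QCircuit.state_zero_of_eq_one _ _ rfl]
      simp [groverCircuit, groverAmp]
  | t + 1, z => by
      obtain ⟨ψ, hψ, hsucc⟩ : ∃ ψ : QBasis I 1 → ℂ,
          (∀ z : QBasis I 1, ψ z = if z.1 ∈ S then boolSign z.2.1 *
            ((if x z.1 ≠ p z.1 then (groverAmp S.card {i ∈ S | x i ≠ p i}.card t).2
              else (groverAmp S.card {i ∈ S | x i ≠ p i}.card t).1 : ℝ) : ℂ) else 0) ∧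
          (groverCircuit hS p T).state x (t + 1) z =
            ((groverStep hS p : unitaryGroup (QBasis I 1) ℂ) :
              Matrix (QBasis I 1) (QBasis I 1) ℂ).mulVec (oracle x ψ) z :=
        ⟨_, groverCircuit_state hS p T x t, rfl⟩
      set d := {i ∈ S | x i ≠ p i}.card with hd
      set v := groverAmp S.card d t with hv
      have hq (i : I) (y : Bool × Fin 1) :
          boolSign (p i) * oracle x ψ (i, y) =
          if i ∈ S then boolSign y.1 * ((if x i ≠ p i then -v.2 else v.1 : ℝ) : ℂ) else 0 := by
        rw [oracle_apply, hψ]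
        simp only [oracleEquiv, Equiv.coe_fn_mk]
        by_cases hi : i ∈ S
        · simp only [hi, if_true]
          rcases Bool.eq_false_or_eq_true (x i) with hx | hx <;>
            rcases Bool.eq_false_or_eq_true (p i) with hp | hp <;>
            rcases Bool.eq_false_or_eq_true y.1 with hy | hy <;>
            simp [boolSign, hx, hp, hy]
        · simp [hi]
      have hsum (y : Bool × Fin 1) :
          ∑ i ∈ S, boolSign (p i) * oracle x ψ (i, y) =
          boolSign y.1 * (((S.card - d) * v.1 - d * v.2 : ℝ) : ℂ) := by
        have hcard : (({i ∈ S | ¬ (x i ≠ p i)}.card : ℝ)) = S.card - d := by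
          have := Finset.card_filter_add_card_filter_not (s := S) (fun i => x i ≠ p i)
          rw [eq_sub_iff_add_eq, add_comm]
          exact_mod_cast this
        rw [Finset.sum_congr rfl fun i hi => (hq i y).trans (if_pos hi), ← Finset.mul_sum,
          ← Complex.ofReal_sum, Finset.sum_ite]
        simp only [Finset.sum_const, nsmul_eq_mul, hcard, ← hd]
        congr 2
        ring
      rw [hsucc, groverStep_mulVec, hsum, hq z.1 z.2]
      by_cases hi : z.1 ∈ S
      · simp only [hi, if_true]
        simp only [groverAmp, ← hv]
        split_ifs
        · push_cast
          ring
        · push_cast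
          ring
      · simp [hi]

/-- An iteration is a rotation by `2θ` in the plane of the marked and unmarked directions. The
factors `sin θ` and `cos θ` stay on the left to avoid division: `cos θ` vanishes when every position
is marked. -/
theorem groverAmp_spec {s d θ : ℝ} (hs : 0 < s) (hθ : s * Real.sin θ ^ 2 = d) : ∀ t : ℕ,
    (groverAmp s d t).2 * Real.sin θ = 1 / Real.sqrt (2 * s) * Real.sin ((2 * t + 1) * θ) ∧
    (groverAmp s d t).1 * Real.cos θ = 1 / Real.sqrt (2 * s) * Real.cos ((2 * t + 1) * θ)
  | 0 => by simp [groverAmp]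
  | t + 1 => by
      obtain ⟨h1, h2⟩ := groverAmp_spec hs hθ t
      simp only [groverAmp]
      set v := groverAmp s d t
      have hm : 2 * ((s - d) * v.1 - d * v.2) / s =
          2 * (Real.cos θ ^ 2 * v.1 - Real.sin θ ^ 2 * v.2) := by
        rw [Real.cos_sq', ← hθ]
        field_simp
      have hang : (2 * ((t + 1 : ℕ) : ℝ) + 1) * θ = (2 * t + 1) * θ + 2 * θ := by
        push_cast
        ring
      have hc := Real.sin_sq_add_cos_sq θ
      rw [hm, hang, Real.sin_add, Real.cos_add, Real.sin_two_mul, Real.cos_two_mul]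
      constructor
      · linear_combination (2 * Real.cos θ * Real.sin θ) * h2 + (2 * Real.cos θ ^ 2 - 1) * h1 +
          (-2 * v.2 * Real.sin θ) * hc
      · linear_combination (2 * Real.cos θ ^ 2 - 1) * h2 - (2 * Real.sin θ * Real.cos θ) * h1

/-- The success probability of `t` Grover iterations. -/
theorem groverCircuit_success {S : Finset I} (hS : S.Nonempty) (p x : I → Bool) {θ : ℝ}
    (hθ : S.card * Real.sin θ ^ 2 = {i ∈ S | x i ≠ p i}.card) (t : ℕ) :
    ∑ z : QBasis I 1, (if z.1 ∈ S ∧ x z.1 ≠ p z.1 then (groverCircuit hS p t).measure x z else 0) =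
      Real.sin ((2 * t + 1) * θ) ^ 2 := by
  have hs : (0 : ℝ) < S.card := by exact_mod_cast hS.card_pos
  set d := {i ∈ S | x i ≠ p i}.card with hd
  have h (z : QBasis I 1) :
      (if z.1 ∈ S ∧ x z.1 ≠ p z.1 then (groverCircuit hS p t).measure x z else 0) =
      if z.1 ∈ S ∧ x z.1 ≠ p z.1 then (groverAmp S.card d t).2 ^ 2 else 0 := by
    split_ifs with hz
    · show ‖(groverCircuit hS p t).state x t z‖ ^ 2 = _
      rw [groverCircuit_state, if_pos hz.1, if_pos hz.2, norm_mul, Complex.norm_real,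
        Real.norm_eq_abs, mul_pow, sq_abs]
      cases z.2.1 <;> simp [boolSign, ← hd]
    · rfl
  rw [Finset.sum_congr rfl fun z _ => h z, Fintype.sum_prod_type]
  have htwo (a : ℝ) : ∑ _ : Bool × Fin 1, a = 2 * a := by simp
  show ∑ i, ∑ _ : Bool × Fin 1,
    (if i ∈ S ∧ x i ≠ p i then (groverAmp S.card d t).2 ^ 2 else 0) = _
  simp only [htwo, ← Finset.mul_sum]
  have hset : Finset.univ.filter (fun i => i ∈ S ∧ x i ≠ p i) = {i ∈ S | x i ≠ p i} := by
    ext i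
    simp
  rw [← Finset.sum_filter, hset, Finset.sum_const, ← hd, nsmul_eq_mul]
  have h1 := (groverAmp_spec hs hθ t).1
  have hsq : (1 / Real.sqrt (2 * S.card)) ^ 2 = 1 / (2 * S.card) := by
    rw [div_pow, Real.sq_sqrt (by positivity), one_pow]
  have h2 := congrArg (· ^ 2) h1
  simp only [mul_pow, hsq] at h2
  have h3 : (groverAmp S.card d t).2 ^ 2 * Real.sin θ ^ 2 * (2 * S.card) =
      Real.sin ((2 * t + 1) * θ) ^ 2 := by
    rw [h2]
    field_simp
  linear_combination h3 - 2 * (groverAmp S.card d t).2 ^ 2 * hθ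

end Grover

/-! ### Quantum search with an unknown number of marked positions -/

section QuantumSearch

/-- This telescopes, since `sin (4 (N + 1) θ) - sin (4 N θ)` equals `2 cos (2 (2 N + 1) θ) sin
(2θ)`. -/
theorem sum_sin_sq (θ : ℝ) (N : ℕ) :
    4 * Real.sin (2 * θ) * ∑ j ∈ Finset.range N, Real.sin ((2 * j + 1) * θ) ^ 2 =
      2 * N * Real.sin (2 * θ) - Real.sin (4 * N * θ) := by
  induction N with
  | zero => simp
  | succ N ih =>
    rw [Finset.sum_range_succ, mul_add, ih]
    have h1 : 4 * ((N + 1 : ℕ) : ℝ) * θ = 2 * ((2 * N + 1) * θ) + 2 * θ := by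
      push_cast
      ring
    have h2 : 4 * (N : ℝ) * θ = 2 * ((2 * N + 1) * θ) - 2 * θ := by ring
    rw [h1, h2, Real.sin_add, Real.sin_sub, Real.cos_two_mul ((2 * (N : ℝ) + 1) * θ), Real.cos_sq']
    push_cast
    ring

/-- By `sum_sin_sq` the sum is at least `N / 2 - 1 / (4 sin (2θ))`. So a random number of iterations
below `N` succeeds with probability at least 1/4, without knowledge of `θ`. -/
theorem quarter_le_sum_sin_sq {θ : ℝ} {N : ℕ} (h : 1 ≤ N * Real.sin (2 * θ)) :
    (N : ℝ) / 4 ≤ ∑ j ∈ Finset.range N, Real.sin ((2 * j + 1) * θ) ^ 2 := by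
  have hpos : 0 < Real.sin (2 * θ) := by
    by_contra hn
    have : (N : ℝ) * Real.sin (2 * θ) ≤ 0 :=
      mul_nonpos_of_nonneg_of_nonpos (Nat.cast_nonneg _) (not_lt.1 hn)
    linarith
  have h1 := sum_sin_sq θ N
  have h2 := Real.sin_le_one (4 * N * θ)
  have h3 : 4 * Real.sin (2 * θ) * (N / 4) ≤
      4 * Real.sin (2 * θ) * ∑ j ∈ Finset.range N, Real.sin ((2 * j + 1) * θ) ^ 2 := by
    rw [h1]
    nlinarith
  exact le_of_mul_le_mul_left h3 (by positivity)

variable {I : Type} [Fintype I] [DecidableEq I]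

/-- Query the positions of a list one after the other until the input is seen to differ from
`p`. -/
def scan [Inhabited I] (p : I → Bool) : List I → Alg (quantum I) I
  | [] => pure default
  | i :: is => do
      let b ← quantAsk i
      if b ≠ p i then pure i else scan p is

/-- Run `t` Grover iterations and check the observed position; continue with `next` if the check
fails. -/
def groverTry {S : Finset I} (hS : S.Nonempty) (p : I → Bool) (t : ℕ) (next : Alg (quantum I) I) :
    Alg (quantum I) I :=
  Alg.step (Q := quantum I) (groverCircuit hS p t) fun z : QBasis I 1 => do
    let b ← quantAsk z.1
    if z.1 ∈ S ∧ b ≠ p z.1 then pure z.1 else next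

/-- Search with an unknown number of marked positions: `k` rounds with increasingly many Grover
iterations, and a classical scan if all of them fail. -/
def groverRounds [Inhabited I] {S : Finset I} (hS : S.Nonempty) (p : I → Bool) :
    ℕ → ℕ → Alg (quantum I) I
  | 0, _ => scan p S.toList
  | k + 1, r => groverTry hS p 0 do
      let j ← quantPick ⌊(6 / 5 : ℝ) ^ r⌋₊
      groverTry hS p j (groverRounds hS p k (r + 1))

open Classical in
/-- The quantum search subroutine. -/
def quantSearch [Inhabited I] (S : Finset I) (p : I → Bool) : Alg (quantum I) I :=
  if hS : S.Nonempty then groverRounds hS p (5 * S.card) 0 else pure default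

variable (x p : I → Bool)

theorem scan_sure [Inhabited I] : ∀ l : List I, (∃ i ∈ l, x i ≠ p i) →
    (scan p l).Sure x (fun i => i ∈ l ∧ x i ≠ p i)
  | [], h => by simp at h
  | i :: is, h => by
      rw [scan]
      refine (quantum.sure_ask x i).bind ?_
      rintro _ rfl
      split_ifs with hi
      · exact ⟨List.mem_cons_self, hi⟩
      · obtain ⟨j, hj, hne⟩ := h
        rcases List.mem_cons.1 hj with rfl | hj
        · exact absurd hne hi
        · exact (scan_sure is ⟨j, hj, hne⟩).mono fun m hm => ⟨List.mem_cons_of_mem _ hm.1, hm.2⟩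

theorem scan_cost [Inhabited I] : ∀ l : List I, (scan p l).expCost x ≤ l.length
  | [] => by
      show (0 : ℝ) ≤ _
      simp
  | i :: is => by
      rw [scan, quantum.expCost_ask_bind, List.length_cons]
      push_cast
      split_ifs with hi
      · show 1 + (0 : ℝ) ≤ _
        have : (0 : ℝ) ≤ is.length := Nat.cast_nonneg _
        linarith
      · linarith [scan_cost is]

variable {S : Finset I} (hS : S.Nonempty)

theorem groverTry_sure (t : ℕ) {next : Alg (quantum I) I}
    (h : next.Sure x (fun i => i ∈ S ∧ x i ≠ p i)) :
    (groverTry hS p t next).Sure x (fun i => i ∈ S ∧ x i ≠ p i) := by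
  intro (z : QBasis I 1) _
  refine (quantum.sure_ask x z.1).bind ?_
  rintro _ rfl
  split_ifs with hz
  · exact hz
  · exact h

theorem groverTry_cost {θ : ℝ} (hθ : S.card * Real.sin θ ^ 2 = {i ∈ S | x i ≠ p i}.card) (t : ℕ)
    (next : Alg (quantum I) I) :
    (groverTry hS p t next).expCost x =
      t + 1 + (1 - Real.sin ((2 * t + 1) * θ) ^ 2) * next.expCost x := by
  show (t : ℝ) + ∑ z : QBasis I 1, (groverCircuit hS p t).measure x z *
    (quantAsk z.1 >>= fun b => if z.1 ∈ S ∧ b ≠ p z.1 then pure z.1 else next).expCost x = _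
  have h (z : QBasis I 1) : (groverCircuit hS p t).measure x z *
      (quantAsk z.1 >>= fun b => if z.1 ∈ S ∧ b ≠ p z.1 then pure z.1 else next).expCost x =
      (groverCircuit hS p t).measure x z * (1 + next.expCost x) -
      (if z.1 ∈ S ∧ x z.1 ≠ p z.1 then (groverCircuit hS p t).measure x z else 0) *
        next.expCost x := by
    rw [quantum.expCost_ask_bind]
    split_ifs
    · show _ * (1 + (0 : ℝ)) = _
      ring
    · ring
  have hsum : ∑ z : QBasis I 1, (groverCircuit hS p t).measure x z = 1 :=
    (groverCircuit hS p t).sum_measure x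
  have hsum' : ∑ z : QBasis I 1, (groverCircuit hS p t).measure x z * (1 + next.expCost x) =
      1 + next.expCost x :=
    (Finset.sum_mul Finset.univ (fun z : QBasis I 1 => (groverCircuit hS p t).measure x z)
      (1 + next.expCost x)).symm.trans (by rw [hsum, one_mul])
  rw [Finset.sum_congr rfl fun z _ => h z, Finset.sum_sub_distrib, hsum',
    ← Finset.sum_mul, groverCircuit_success hS p x hθ]
  ring

variable [Inhabited I]

theorem groverRounds_sure (hd : ∃ i ∈ S, x i ≠ p i) : ∀ k r : ℕ,
    (groverRounds hS p k r).Sure x (fun i => i ∈ S ∧ x i ≠ p i)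
  | 0, _ => by
      rw [groverRounds]
      exact (scan_sure x p _ (by simpa using hd)).mono fun i hi => by simpa using hi
  | k + 1, r => by
      rw [groverRounds]
      refine groverTry_sure x p hS 0 ?_
      refine (quantum.sure_pick x _).bind fun j _ => ?_
      exact groverTry_sure x p hS j (groverRounds_sure hd k (r + 1))

theorem one_le_growth (r : ℕ) : (1 : ℝ) ≤ (6 / 5) ^ r := one_le_pow₀ (by norm_num)

/-- The cost of a round in terms of the cost of the following rounds and of the average success
probability. -/
theorem groverRounds_succ_cost {θ : ℝ}
    (hθ : S.card * Real.sin θ ^ 2 = {i ∈ S | x i ≠ p i}.card) (k r : ℕ) :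
    ∃ N : ℕ, (6 / 5 : ℝ) ^ r ≤ N ∧ 0 < N ∧
    (groverRounds hS p (k + 1) r).expCost x ≤ 3 * (6 / 5) ^ r +
      (1 - Real.sin θ ^ 2) *
      (1 - (∑ j ∈ Finset.range N, Real.sin ((2 * j + 1) * θ) ^ 2) / N) *
      (groverRounds hS p k (r + 1)).expCost x := by
  set m := ⌊(6 / 5 : ℝ) ^ r⌋₊ with hm
  set W := (groverRounds hS p k (r + 1)).expCost x with hW
  -- The factor 3 collects one checking query of the first try and at most `m + 1` queries of the
  -- second, with `m ≤ (6/5)^r` and `1 ≤ (6/5)^r`.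
  refine ⟨m + 1, by push_cast; exact (Nat.lt_floor_add_one _).le, by omega, ?_⟩
  rw [groverRounds, groverTry_cost x p hS hθ, quantum.expCost_pick_bind]
  simp only [groverTry_cost x p hS hθ, ← hW, ← hm]
  have hmle : (m : ℝ) ≤ (6 / 5) ^ r := Nat.floor_le (by positivity)
  have hsum : ∑ j : Fin (m + 1), ((j : ℕ) + 1 + (1 - Real.sin ((2 * (j : ℕ) + 1) * θ) ^ 2) * W) ≤
      (m + 1) * (m + 1) +
      ((m + 1) - ∑ j ∈ Finset.range (m + 1), Real.sin ((2 * j + 1) * θ) ^ 2) * W := by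
    rw [Finset.sum_range, Finset.sum_add_distrib, ← Finset.sum_mul, Finset.sum_sub_distrib]
    have h1 : ∑ j : Fin (m + 1), (((j : ℕ) : ℝ) + 1) ≤ (m + 1) * (m + 1) := by
      refine (Finset.sum_le_card_nsmul _ _ ((m : ℝ) + 1) fun j _ => ?_).trans_eq ?_
      · have : ((j : ℕ) : ℝ) ≤ m := by exact_mod_cast Nat.lt_succ_iff.1 j.2
        linarith
      · rw [Finset.card_univ, Fintype.card_fin, nsmul_eq_mul]
        push_cast
        ring
    have h2 : ∑ _ : Fin (m + 1), (1 : ℝ) = m + 1 := by simp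
    rw [h2]
    linarith
  have hdiv := div_le_div_of_nonneg_right hsum (by positivity : (0 : ℝ) ≤ m + 1)
  have hc : 0 ≤ 1 - Real.sin θ ^ 2 := by
    rw [← Real.cos_sq']
    positivity
  have hmul := mul_le_mul_of_nonneg_left hdiv hc
  have e : ((m + 1) * (m + 1) + (((m : ℝ) + 1) -
      ∑ j ∈ Finset.range (m + 1), Real.sin ((2 * j + 1) * θ) ^ 2) * W) / (m + 1) =
      (m + 1) +
        (1 - (∑ j ∈ Finset.range (m + 1), Real.sin ((2 * j + 1) * θ) ^ 2) / (m + 1)) * W := by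
    generalize ∑ j ∈ Finset.range (m + 1), Real.sin ((2 * j + 1) * θ) ^ 2 = a
    field_simp
  rw [e, mul_add] at hmul
  have hle : (1 - Real.sin θ ^ 2) * ((m : ℝ) + 1) ≤ m + 1 :=
    mul_le_of_le_one_left (by positivity) (by nlinarith [sq_nonneg (Real.sin θ)])
  have h1 := one_le_growth r
  push_cast
  simp only [mul_zero, zero_add, one_mul]
  linarith

/-- The probability that a round fails. -/
theorem groverRound_fail {s d θ : ℝ} (hs : 0 < s) (hd : 0 < d)
    (hθ0 : 0 ≤ Real.sin θ) (hc0 : 0 ≤ Real.cos θ)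
    (hθ : s * Real.sin θ ^ 2 = d) {N : ℕ} (hN : Real.sqrt (s / d) ≤ N) (hN0 : 0 < N) :
    (1 - Real.sin θ ^ 2) *
      (1 - (∑ j ∈ Finset.range N, Real.sin ((2 * j + 1) * θ) ^ 2) / N) ≤ 3 / 4 := by
  have hN' : (0 : ℝ) < N := by exact_mod_cast hN0
  have hc : 0 ≤ 1 - Real.sin θ ^ 2 := by
    rw [← Real.cos_sq']
    positivity
  have havg : 0 ≤ (∑ j ∈ Finset.range N, Real.sin ((2 * j + 1) * θ) ^ 2) / N :=
    div_nonneg (Finset.sum_nonneg fun _ _ => sq_nonneg _) (Nat.cast_nonneg _)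
  have havg1 : (∑ j ∈ Finset.range N, Real.sin ((2 * j + 1) * θ) ^ 2) / N ≤ 1 := by
    rw [div_le_one hN']
    refine (Finset.sum_le_card_nsmul _ _ 1 fun j _ => Real.sin_sq_le_one _).trans ?_
    simp
  -- If at most three quarters of the positions are marked, then `cos θ ≥ 1/2` and `sin (2θ) ≥ sin θ
  -- = √(d / s)`, so the random iterations succeed often enough. Otherwise the try without
  -- iterations already does.
  by_cases h : Real.sin θ ^ 2 ≤ 3 / 4
  · have hsin : Real.sqrt (s / d) * Real.sin θ = 1 := by
      have hpos : s / d * Real.sin θ ^ 2 = 1 := by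
        rw [div_mul_eq_mul_div, hθ, div_self hd.ne']
      rw [← Real.sqrt_sq hθ0, ← Real.sqrt_mul (by positivity), hpos, Real.sqrt_one]
    have hcos : 1 / 2 ≤ Real.cos θ := by
      have h2 := Real.sin_sq_add_cos_sq θ
      refine (sq_le_sq₀ (by norm_num) hc0).1 ?_
      linarith
    have hq := quarter_le_sum_sin_sq (θ := θ) (N := N) (by
      rw [Real.sin_two_mul]
      have h3 : 1 ≤ N * Real.sin θ := by
        rw [← hsin]
        exact mul_le_mul_of_nonneg_right hN hθ0
      have h4 := mul_le_mul h3 hcos (by norm_num) (by positivity)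
      linarith)
    have hq' : 1 / 4 ≤ (∑ j ∈ Finset.range N, Real.sin ((2 * j + 1) * θ) ^ 2) / N := by
      rw [le_div_iff₀ hN']
      linarith
    exact (mul_le_of_le_one_left (by linarith) (by linarith [sq_nonneg (Real.sin θ)])).trans
      (by linarith)
  · exact (mul_le_of_le_one_right hc (by linarith)).trans (by linarith)

/-- Once the range reaches `√(s / d)`, each round fails with probability at most 3/4, and `3/4 * 6/5
< 1` makes the costs summable. With `g = (6/5)^r` the constant 30 solves `3 g + 3/4 * 30 * (6/5) g =
30 g`. -/
theorem groverRounds_cost_late {θ : ℝ} (hd : 0 < {i ∈ S | x i ≠ p i}.card)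
    (hθ0 : 0 ≤ Real.sin θ) (hc0 : 0 ≤ Real.cos θ)
    (hθ : S.card * Real.sin θ ^ 2 = {i ∈ S | x i ≠ p i}.card) : ∀ k r : ℕ,
    Real.sqrt (S.card / {i ∈ S | x i ≠ p i}.card) ≤ (6 / 5) ^ r →
    S.card ≤ (6 / 5 : ℝ) ^ (r + k) →
    (groverRounds hS p k r).expCost x ≤ 30 * (6 / 5) ^ r
  | 0, r, _, hs => by
      rw [groverRounds]
      refine (scan_cost x p _).trans ?_
      rw [Finset.length_toList]
      have := one_le_growth r
      rw [add_zero] at hs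
      linarith
  | k + 1, r, hr, hs => by
      obtain ⟨N, hN, hN0, hcost⟩ := groverRounds_succ_cost x p hS hθ k r
      have ih := groverRounds_cost_late hd hθ0 hc0 hθ k (r + 1)
        (hr.trans (pow_le_pow_right₀ (by norm_num) (by omega))) (by rwa [add_right_comm, add_assoc])
      have hf := groverRound_fail (by exact_mod_cast hS.card_pos) (by exact_mod_cast hd) hθ0 hc0 hθ
        (hr.trans hN) hN0
      have hW := Alg.expCost_nonneg (quantum.isProb x) (groverRounds hS p k (r + 1))
      have := mul_le_mul_of_nonneg_right hf hW
      rw [pow_succ] at ih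
      linarith

/-- Before that point no success is assumed, and the round costs form a geometric sum: `3 g - 15 *
(6/5) g = -15 g` with `g = (6/5)^r`. The constant 54 makes this meet the late bound `30 g` at the
largest admissible `g = 6/5 √(s / d)`. -/
theorem groverRounds_cost_early {θ : ℝ} (hd : 0 < {i ∈ S | x i ≠ p i}.card)
    (hθ0 : 0 ≤ Real.sin θ) (hc0 : 0 ≤ Real.cos θ)
    (hθ : S.card * Real.sin θ ^ 2 = {i ∈ S | x i ≠ p i}.card) : ∀ k r : ℕ,
    (6 / 5) ^ r ≤ 6 / 5 * Real.sqrt (S.card / {i ∈ S | x i ≠ p i}.card) →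
    S.card ≤ (6 / 5 : ℝ) ^ (r + k) →
    (groverRounds hS p k r).expCost x ≤
      54 * Real.sqrt (S.card / {i ∈ S | x i ≠ p i}.card) - 15 * (6 / 5) ^ r := by
  intro k r hr hs
  by_cases hlate : Real.sqrt (S.card / {i ∈ S | x i ≠ p i}.card) ≤ (6 / 5) ^ r
  · refine (groverRounds_cost_late x p hS hd hθ0 hc0 hθ k r hlate hs).trans ?_
    linarith
  · rw [not_le] at hlate
    match k with
    | 0 =>
      -- With no rounds left, `|S| ≤ (6/5)^r < √(|S| / d) ≤ |S|`.
      exfalso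
      have hS1 : (1 : ℝ) ≤ S.card := by exact_mod_cast hS.card_pos
      have hd1 : (1 : ℝ) ≤ {i ∈ S | x i ≠ p i}.card := by exact_mod_cast hd
      have : Real.sqrt (S.card / {i ∈ S | x i ≠ p i}.card) ≤ S.card := by
        rw [Real.sqrt_le_left (by positivity)]
        calc (S.card : ℝ) / {i ∈ S | x i ≠ p i}.card ≤ S.card := div_le_self (by positivity) hd1
          _ ≤ S.card ^ 2 := by nlinarith
      rw [add_zero] at hs
      linarith
    | k + 1 =>
      obtain ⟨N, hN, hN0, hcost⟩ := groverRounds_succ_cost x p hS hθ k r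
      have ih := groverRounds_cost_early hd hθ0 hc0 hθ k (r + 1)
        (by rw [pow_succ]; linarith) (by rwa [add_right_comm, add_assoc])
      have hW := Alg.expCost_nonneg (quantum.isProb x) (groverRounds hS p k (r + 1))
      have hf : (1 - Real.sin θ ^ 2) *
          (1 - (∑ j ∈ Finset.range N, Real.sin ((2 * j + 1) * θ) ^ 2) / N) ≤ 1 := by
        have hc : 0 ≤ 1 - Real.sin θ ^ 2 := by
          rw [← Real.cos_sq']
          positivity
        have havg : 0 ≤ (∑ j ∈ Finset.range N, Real.sin ((2 * j + 1) * θ) ^ 2) / N :=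
          div_nonneg (Finset.sum_nonneg fun _ _ => sq_nonneg _) (Nat.cast_nonneg _)
        exact (mul_le_of_le_one_right hc (by linarith)).trans
          (by linarith [sq_nonneg (Real.sin θ)])
      have := mul_le_mul_of_nonneg_right hf hW
      rw [pow_succ] at ih
      linarith

theorem quantSearch_isSearch :
    IsSearch (quantSearch (I := I)) (fun s d => 54 * Real.sqrt (s / d)) := by
  intro x S p hd
  have hS : S.Nonempty := hd.imp fun i hi => hi.1
  have hdpos : 0 < {i ∈ S | x i ≠ p i}.card := by
    obtain ⟨i, hi⟩ := hd
    exact Finset.card_pos.2 ⟨i, by simpa using hi⟩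
  have hS1 : (0 : ℝ) < S.card := by exact_mod_cast hS.card_pos
  have hle : ({i ∈ S | x i ≠ p i}.card : ℝ) ≤ S.card := by
    exact_mod_cast Finset.card_filter_le _ _
  have hd1 : (0 : ℝ) < {i ∈ S | x i ≠ p i}.card := by exact_mod_cast hdpos
  rw [quantSearch, dif_pos hS]
  refine ⟨(Alg.prob_eq_one_iff (quantum.isProb x) _ _).2 (groverRounds_sure x p hS hd _ _), ?_⟩
  set d := {i ∈ S | x i ≠ p i}.card with hdef
  set q : ℝ := Real.sqrt (d / S.card) with hq
  have hsin : Real.sin (Real.arcsin q) = q :=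
    Real.sin_arcsin (by linarith [Real.sqrt_nonneg ((d : ℝ) / S.card)])
      (Real.sqrt_le_one.2 ((div_le_one hS1).2 hle))
  -- Bernoulli's inequality: after `5 |S|` rounds the final scan costs no more than a round would.
  have hgrow : (S.card : ℝ) ≤ (6 / 5) ^ (0 + 5 * S.card) := by
    have := one_add_mul_le_pow (a := (1 / 5 : ℝ)) (by norm_num) (5 * S.card)
    rw [zero_add]
    norm_num at this ⊢
    linarith
  refine (groverRounds_cost_early x p hS (θ := Real.arcsin q) hdpos ?_ (Real.cos_arcsin_nonneg _)
    ?_ (5 * S.card) 0 ?_ hgrow).trans ?_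
  · rw [hsin]
    positivity
  · rw [hsin, hq, Real.sq_sqrt (by positivity), ← hdef]
    field_simp
  · have : 1 ≤ Real.sqrt (S.card / d) := Real.one_le_sqrt.2 ((one_le_div hd1).2 hle)
    rw [pow_zero]
    linarith
  · rw [pow_zero, ← hdef]
    linarith

end QuantumSearch

/-! ### Quicksort of the rows of a half graph -/

section QuicksortAnalysis

variable {n : ℕ} {Q : QueryModel (Cell n)}

/-- On input `x`, the three subroutines of the quicksort-type learner behave as they should for
the string `y`, which is `x` itself or its transpose. -/
structure QuicksortSpec (x y : Cell n → Bool) (ask : Cell n → Alg Q Bool)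
    (pick : (k : ℕ) → Alg Q (Fin (k + 1)))
    (search : Finset (Cell n) → (Cell n → Bool) → Alg Q (Cell n))
    (bound : ℝ → ℝ → ℝ) : Prop where
  isProb : Q.IsProb x
  ask_meets : ∀ z, (ask z).Meets x (· = y z) 1
  pick_sure : ∀ k, (pick k).Sure x (fun _ => True)
  pick_cost : ∀ {R : Type} (k : ℕ) (f : Fin (k + 1) → Alg Q R),
    (pick k >>= f).expCost x = (∑ j, (f j).expCost x) / (k + 1)
  search_meets : ∀ S p, (∃ i ∈ S, y i ≠ p i) →
    (search S p).Meets x (fun i => i ∈ S ∧ y i ≠ p i) (bound S.card {i ∈ S | y i ≠ p i}.card)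

variable {x y : Cell n → Bool} {ask : Cell n → Alg Q Bool}
  {pick : (k : ℕ) → Alg Q (Fin (k + 1))}
  {search : Finset (Cell n) → (Cell n → Bool) → Alg Q (Cell n)} {bound : ℝ → ℝ → ℝ}

theorem QuicksortSpec.queryRow_meets (h : QuicksortSpec x y ask pick search bound) (i : Fin n) :
    ∀ cols : List (Fin n),
      (queryRow ask i cols).Meets x (fun p => ∀ c ∈ cols, p c = y (i, c)) cols.length
  | [] => Alg.meets_ret (by simp) (by simp)
  | c :: cs => by
      rw [queryRow]
      refine (h.ask_meets (i, c)).bind h.isProb (B' := cs.length) ?_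
        (by rw [List.length_cons]; push_cast; linarith)
      rintro _ rfl
      refine (h.queryRow_meets i cs).bind h.isProb (B' := 0) ?_ (by simp)
      intro p hp
      refine Alg.meets_ret ?_ le_rfl
      intro c' hc'
      by_cases hcc : c' = c
      · subst hcc
        simp
      · rw [Function.update_of_ne hcc]
        exact hp c' ((List.mem_cons.1 hc').resolve_left hcc)

variable {σ τ : Equiv.Perm (Fin n)}

/-- Two rows differ in as many columns as their ranks differ by, provided that all the columns
separating them are present. -/
theorem card_differing (j r : Fin n) (cols : Finset (Fin n)) (p : Fin n → Bool)
    (hp : ∀ c ∈ cols, p c = decide (τ c ≤ σ r))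
    (hcols : ∀ c, min (σ j) (σ r) < τ c → τ c ≤ max (σ j) (σ r) → c ∈ cols) :
    {z ∈ ({j} ×ˢ cols : Finset (Cell n)) | decide (τ z.2 ≤ σ z.1) ≠ p z.2}.card =
      ((σ j : ℕ) - σ r + (σ r - σ j)) := by
  have himage : ({z ∈ ({j} ×ˢ cols : Finset (Cell n)) | decide (τ z.2 ≤ σ z.1) ≠ p z.2}).image
      (fun z => τ z.2) = Finset.Ioc (min (σ j) (σ r)) (max (σ j) (σ r)) := by
    ext v
    simp only [Finset.mem_image, Finset.mem_filter, Finset.mem_product, Finset.mem_singleton,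
      Finset.mem_Ioc, Prod.exists]
    constructor
    · rintro ⟨i, c, ⟨⟨hi, hc⟩, hne⟩, rfl⟩
      rw [hp c hc, hi] at hne
      rw [min_lt_iff, le_max_iff]
      by_contra hcon
      apply hne
      rw [decide_eq_decide]
      by_cases h1 : τ c ≤ σ j <;> by_cases h2 : τ c ≤ σ r <;> simp_all
    · rintro ⟨h1, h2⟩
      have hc : τ.symm v ∈ cols := hcols _ (by simpa using h1) (by simpa using h2)
      refine ⟨j, τ.symm v, ⟨⟨rfl, hc⟩, ?_⟩, by simp⟩
      rw [hp _ hc, Ne, decide_eq_decide]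
      simp only [Equiv.apply_symm_apply]
      rw [min_lt_iff] at h1
      rw [le_max_iff] at h2
      intro hiff
      rcases h1 with h1 | h1 <;> rcases h2 with h2 | h2
      · exact absurd h2 (not_le.2 h1)
      · exact absurd (hiff.2 h2) (not_le.2 h1)
      · exact absurd (hiff.1 h2) (not_le.2 h1)
      · exact absurd h2 (not_le.2 h1)
  rw [← Finset.card_image_of_injOn (f := fun z : Cell n => τ z.2), himage, Fin.card_Ioc]
  · rcases le_total (σ j) (σ r) with h | h
    · rw [max_eq_right h, min_eq_left h]
      have : (σ j : ℕ) ≤ σ r := h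
      omega
    · rw [max_eq_left h, min_eq_right h]
      have : (σ r : ℕ) ≤ σ j := h
      omega
  · rintro ⟨a, b⟩ hz ⟨a', b'⟩ hz' heq
    simp only [Finset.coe_filter, Finset.mem_product, Finset.mem_singleton, Set.mem_ofPred_eq]
      at hz hz'
    have hb : b = b' := τ.injective heq
    rw [hz.1.1, hz'.1.1, hb]

/-- If the search finds column `c` with pivot bit 1, then `σ j < τ c ≤ σ r`; with pivot bit 0 the
inequalities turn around. Since all separating columns are present, the number of marked positions
is the rank distance, which is positive for `j ≠ r`. -/
theorem QuicksortSpec.splitRows_meets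
    (h : QuicksortSpec x (fun z => decide (τ z.2 ≤ σ z.1)) ask pick search bound)
    (r : Fin n) (cols : List (Fin n)) (p : Fin n → Bool)
    (hp : ∀ c ∈ cols, p c = decide (τ c ≤ σ r)) :
    ∀ js : List (Fin n), (∀ j ∈ js, j ≠ r) →
      (∀ j ∈ js, ∀ c, min (σ j) (σ r) < τ c → τ c ≤ max (σ j) (σ r) → c ∈ cols) →
      (splitRows search p cols js).Meets x
        (fun s => s = (js.filter (fun j => σ j < σ r), js.filter (fun j => σ r < σ j)))
        (js.map fun j =>
          bound cols.toFinset.card ((σ j : ℕ) - σ r + (σ r - σ j) : ℕ)).sum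
  | [], _, _ => Alg.meets_ret (by simp) (by simp)
  | j :: js, hne, hcols => by
      have hcard := card_differing j r cols.toFinset p (by simpa using hp)
        (by simpa using hcols j List.mem_cons_self)
      have hjr : σ j ≠ σ r := fun he => hne j List.mem_cons_self (σ.injective he)
      have hjr' : (σ j : ℕ) ≠ σ r := fun he => hjr (Fin.ext he)
      rw [splitRows, List.map_cons, List.sum_cons]
      have hs := h.search_meets ({j} ×ˢ cols.toFinset) (fun z => p z.2) (by
        have hpos : 0 < ({z ∈ ({j} ×ˢ cols.toFinset : Finset (Cell n)) |
            decide (τ z.2 ≤ σ z.1) ≠ p z.2}).card := by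
          rw [hcard]
          omega
        obtain ⟨z, hz⟩ := Finset.card_pos.1 hpos
        exact ⟨z, (Finset.mem_filter.1 hz).1, (Finset.mem_filter.1 hz).2⟩)
      rw [hcard, Finset.card_product, Finset.card_singleton, one_mul] at hs
      refine hs.bind h.isProb ?_ le_rfl
      rintro ⟨j', c⟩ ⟨hz, hzne⟩
      simp only [Finset.mem_product, Finset.mem_singleton, List.mem_toFinset] at hz hzne
      obtain ⟨rfl, hc⟩ := hz
      refine (h.splitRows_meets r cols p hp js (fun i hi => hne i (List.mem_cons_of_mem _ hi))
        (fun i hi => hcols i (List.mem_cons_of_mem _ hi))).bind h.isProb (B' := 0) ?_ (by simp)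
      rintro _ rfl
      refine Alg.meets_ret ?_ le_rfl
      rw [hp c hc] at hzne ⊢
      by_cases hcr : τ c ≤ σ r
      · have hlt : σ j' < σ r := by
          by_contra hcon
          have := hcr.trans (not_lt.1 hcon)
          simp_all
        simp [hcr, hlt, hlt.le]
      · have hlt : σ r < σ j' := by
          have : τ c ≤ σ j' := by
            by_contra hcon
            simp_all
          exact (not_le.1 hcr).trans_le this
        simp [hcr, hlt, hlt.le]

/-- The bound on the expected cost of sorting `m` rows when a pivot costs `D * m`. -/
def sortCost (D : ℝ) (m : ℕ) : ℝ := if m ≤ 1 then 0 else 2 * D * ((m + 1) * harmonic m)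

theorem harmonic_cast_nonneg (m : ℕ) : (0 : ℝ) ≤ harmonic m := by
  rw [harmonic]
  push_cast
  positivity

theorem sortCost_le {D : ℝ} (hD : 0 ≤ D) (m : ℕ) :
    sortCost D m ≤ 2 * D * ((m + 1) * harmonic m) := by
  unfold sortCost
  split_ifs
  · have := harmonic_cast_nonneg m
    positivity
  · exact le_rfl

/-- `2 D (m + 1) H_m` is a supersolution of the quicksort recurrence `m T_m = D m² + 2 ∑_{k < m}
T_k`. -/
theorem sum_harmonic_le (D : ℝ) (hD : 0 ≤ D) (m : ℕ) :
    D * m ^ 2 + 2 * ∑ k ∈ Finset.range m, 2 * D * ((k + 1) * (harmonic k : ℝ)) ≤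
      m * (2 * D * ((m + 1) * harmonic m)) := by
  induction m with
  | zero => simp
  | succ m ih =>
    rw [Finset.sum_range_succ, harmonic_succ]
    push_cast
    have h : ((m : ℝ) + 1) * ((m : ℝ) + 1)⁻¹ = 1 := mul_inv_cancel₀ (by positivity)
    have e : ((m : ℝ) + 1) * (2 * D * ((m + 1 + 1) * (harmonic m + (m + 1 : ℝ)⁻¹))) =
        ((m : ℝ) + 1) * (2 * D * ((m + 1 + 1) * harmonic m)) + 2 * D * (m + 2) := by
      linear_combination (2 * D * (m + 2)) * h
    rw [e]
    nlinarith

theorem sum_map_of_perm_range' {α : Type} {l : List α} {f : α → ℕ} {a m : ℕ}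
    (h : (l.map f).Perm (List.range' a m)) (g : ℕ → ℝ) :
    (l.map fun i => g (f i - a)).sum = ∑ k ∈ Finset.range m, g k := by
  have h1 := (h.map (fun v => g (v - a))).sum_eq
  rw [List.map_map, List.range'_eq_map_range, List.map_map] at h1
  have h2 : (fun v => g (v - a)) ∘ (fun x => a + x) = g := by
    ext v
    simp
  rw [h2] at h1
  exact h1

/-- Invariant: the rows have ranks `a, …, a + m - 1`, the columns have ranks between `a` and `a +
m`, and every column rank strictly between these ends is present; the two end columns separate no
rows of the list. A pivot of rank `a + κ` splits this into the same invariant for `(a, κ)` and `(a +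
κ + 1, m - 1 - κ)`. The hypothesis `hD` says that one pivot with all its comparisons costs at most
`D m`. -/
theorem QuicksortSpec.quicksortRows_meets
    (h : QuicksortSpec x (fun z => decide (τ z.2 ≤ σ z.1)) ask pick search bound)
    {D : ℝ} (hD0 : 0 ≤ D)
    (hD : ∀ m s k : ℕ, 2 ≤ m → m ≤ n → k < m → s ≤ m + 1 →
      (m : ℝ) + 1 + ∑ j ∈ (Finset.range m).erase k, bound s (j - k + (k - j) : ℕ) ≤ D * m) :
    ∀ (f a m : ℕ) (rows cols : List (Fin n)), m ≤ f →
      (rows.map (fun i => (σ i : ℕ))).Perm (List.range' a m) → cols.Nodup →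
      (∀ c ∈ cols, a ≤ τ c ∧ (τ c : ℕ) ≤ a + m) →
      (∀ c, a < τ c → (τ c : ℕ) < a + m → c ∈ cols) →
      (quicksortRows ask pick search f rows cols).Meets x
        (fun L => L.map (fun i => (σ i : ℕ)) = List.range' a m) (sortCost D m)
  | 0, a, m, rows, cols, hf, hrows, _, _, _ => by
      have hm : m = 0 := by omega
      subst hm
      rw [quicksortRows]
      exact Alg.meets_ret (by simp) (by simp [sortCost])
  | f + 1, a, m, [], cols, hf, hrows, _, _, _ => by
      have hm : m = 0 := by simpa using hrows.length_eq.symm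
      subst hm
      rw [quicksortRows]
      exact Alg.meets_ret (by simp) (by simp [sortCost])
  | f + 1, a, m, [r], cols, hf, hrows, _, _, _ => by
      have hm : m = 1 := by simpa using hrows.length_eq.symm
      subst hm
      rw [quicksortRows]
      exact Alg.meets_ret (by simpa using hrows) (by simp [sortCost])
  | f + 1, a, m, r :: r' :: rs, cols, hf, hrows, hnd, hlow, hup => by
      rw [quicksortRows]
      set l := r :: r' :: rs with hl
      have hlen : l.length = m := by simpa using hrows.length_eq
      have hm2 : 2 ≤ m := by
        rw [← hlen, hl]
        simp
      have hlnd : l.Nodup := List.Nodup.of_map _ (hrows.nodup_iff.2 List.nodup_range')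
      have hmn : m ≤ n := by simpa [hlen] using hlnd.length_le_card
      have hmem (i : Fin n) : i ∈ l ↔ a ≤ σ i ∧ (σ i : ℕ) < a + m := by
        rw [← List.mem_range'_1, ← hrows.mem_iff, List.mem_map]
        constructor
        · exact fun hi => ⟨i, hi, rfl⟩
        · rintro ⟨j, hj, he⟩
          rwa [← σ.injective (Fin.ext he)]
      have hcl : cols.length ≤ m + 1 := by
        have h1 : (cols.toFinset.image (fun c => (τ c : ℕ))) ⊆ Finset.Icc a (a + m) := by
          intro v hv
          simp only [Finset.mem_image, List.mem_toFinset] at hv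
          obtain ⟨c, hc, rfl⟩ := hv
          exact Finset.mem_Icc.2 (hlow c hc)
        have h2 := Finset.card_le_card h1
        rw [Finset.card_image_of_injective _ (fun c c' hcc => τ.injective (Fin.ext hcc)),
          List.toFinset_card_of_nodup hnd, Nat.card_Icc] at h2
        omega
      -- The cost bound given that the pivot has relative rank `k`.
      set g : ℕ → ℝ := fun k => D * m + (sortCost D k + sortCost D (m - 1 - k)) with hg
      have hbranch (k : Fin l.length) : ((do
          let p ← queryRow ask (l.get k) cols
          let s ← splitRows search p cols (l.eraseIdx k)
          let a ← quicksortRows ask pick search f s.1 (cols.filter (fun c => p c))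
          let b ← quicksortRows ask pick search f s.2 (cols.filter (fun c => !p c))
          pure (a ++ l.get k :: b)) : Alg Q (List (Fin n))).Meets x
          (fun L => L.map (fun i => (σ i : ℕ)) = List.range' a m)
          (g ((σ (l.get k) : ℕ) - a)) := by
        set v := l.get k with hv
        obtain ⟨hva, hvm⟩ := (hmem v).1 (List.get_mem _ _)
        obtain ⟨κ, hκ⟩ := Nat.exists_eq_add_of_le hva
        have hκm : κ < m := by omega
        have hperm : (v :: l.eraseIdx k).Perm l := List.getElem_cons_eraseIdx_perm k.2
        have hnd' := hperm.nodup_iff.2 hlnd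
        rw [List.nodup_cons] at hnd'
        have hmem' (i : Fin n) : i ∈ l.eraseIdx k ↔ i ≠ v ∧ a ≤ σ i ∧ (σ i : ℕ) < a + m := by
          rw [← hmem, ← hperm.mem_iff, List.mem_cons]
          constructor
          · exact fun hi => ⟨fun he => hnd'.1 (he ▸ hi), Or.inr hi⟩
          · exact fun hi => hi.2.resolve_left hi.1
        have hsum : (cols.length : ℝ) + ((l.eraseIdx k).map fun j =>
            bound cols.toFinset.card ((σ j : ℕ) - σ v + (σ v - σ j) : ℕ)).sum ≤ D * m := by
          -- The relative ranks of the rows run once through `0, …, m - 1`. The pivot's own term, at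
          -- distance 0, is removed on both sides, so no assumption on `bound` at 0 is needed.
          have h1 := sum_map_of_perm_range' hrows
            (fun j => bound cols.toFinset.card (j - κ + (κ - j) : ℕ))
          have h2 := (hperm.map (fun j =>
            bound cols.toFinset.card ((σ j : ℕ) - a - κ + (κ - (σ j - a)) : ℕ))).sum_eq
          rw [List.map_cons, List.sum_cons] at h2
          have h3 := hD m cols.toFinset.card κ hm2 hmn hκm
            ((List.toFinset_card_le _).trans hcl)
          rw [Finset.sum_erase_eq_sub (Finset.mem_range.2 hκm), ← h1, ← h2] at h3
          have h4 : ((l.eraseIdx k).map fun j =>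
              bound cols.toFinset.card ((σ j : ℕ) - σ v + (σ v - σ j) : ℕ)) =
              ((l.eraseIdx k).map fun j =>
              bound cols.toFinset.card ((σ j : ℕ) - a - κ + (κ - (σ j - a)) : ℕ)) := by
            refine List.map_congr_left fun j hj => ?_
            have := ((hmem' j).1 hj).2
            congr 2
            omega
          rw [h4]
          have h5 : (σ v : ℕ) - a - κ + (κ - (σ v - a)) = κ - κ + (κ - κ) := by omega
          rw [h5] at h3
          have h6 : (cols.length : ℝ) ≤ m + 1 := by exact_mod_cast hcl
          linarith
        have hgκ : (σ v : ℕ) - a = κ := by omega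
        rw [hgκ]
        have hsub1 : (((l.eraseIdx k).filter (fun j => σ j < σ v)).map
            (fun i => (σ i : ℕ))).Perm (List.range' a κ) := by
          rw [List.perm_ext_iff_of_nodup
            ((hnd'.2.filter _).map fun i j hij => σ.injective (Fin.ext hij)) List.nodup_range']
          intro u
          simp only [List.mem_map, List.mem_filter, hmem', List.mem_range'_1, decide_eq_true_eq]
          constructor
          · rintro ⟨i, ⟨⟨_, h1, h2⟩, h3⟩, rfl⟩
            have : (σ i : ℕ) < σ v := h3
            omega
          · rintro ⟨h1, h2⟩
            have hun : u < n := by have := (σ v).2; omega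
            refine ⟨σ.symm ⟨u, hun⟩, ?_, by simp⟩
            rw [Equiv.apply_symm_apply]
            refine ⟨⟨?_, h1, by show u < a + m; omega⟩, by rw [Fin.lt_def]; show u < _; omega⟩
            intro he
            rw [← he] at hκ
            simp at hκ
            omega
        have hsub2 : (((l.eraseIdx k).filter (fun j => σ v < σ j)).map
            (fun i => (σ i : ℕ))).Perm (List.range' (a + κ + 1) (m - 1 - κ)) := by
          rw [List.perm_ext_iff_of_nodup
            ((hnd'.2.filter _).map fun i j hij => σ.injective (Fin.ext hij)) List.nodup_range']
          intro u
          simp only [List.mem_map, List.mem_filter, hmem', List.mem_range'_1, decide_eq_true_eq]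
          constructor
          · rintro ⟨i, ⟨⟨_, h1, h2⟩, h3⟩, rfl⟩
            have : (σ v : ℕ) < σ i := h3
            omega
          · rintro ⟨h1, h2⟩
            have hum : u ∈ List.range' a m := List.mem_range'_1.2 (by omega)
            rw [← hrows.mem_iff, List.mem_map] at hum
            obtain ⟨i, hi, rfl⟩ := hum
            refine ⟨i, ⟨⟨?_, (hmem i).1 hi⟩, ?_⟩, rfl⟩
            · rintro rfl
              omega
            · rw [Fin.lt_def]
              omega
        refine (h.queryRow_meets v cols).bind h.isProb
          (B' := ((l.eraseIdx k).map fun j =>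
            bound cols.toFinset.card ((σ j : ℕ) - σ v + (σ v - σ j) : ℕ)).sum +
            (sortCost D κ + sortCost D (m - 1 - κ))) ?_ (by simp only [hg]; linarith)
        intro p hp
        refine (h.splitRows_meets v cols p hp (l.eraseIdx k) (fun j hj => ((hmem' j).1 hj).1)
          ?_).bind h.isProb ?_ le_rfl
        · intro j hj c h1 h2
          have hj' := ((hmem' j).1 hj).2
          refine hup c ?_ ?_
          · rcases min_lt_iff.1 h1 with h1 | h1 <;> rw [Fin.lt_def] at h1 <;> omega
          · rcases le_max_iff.1 h2 with h2 | h2 <;> rw [Fin.le_def] at h2 <;> omega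
        rintro _ rfl
        refine (h.quicksortRows_meets hD0 hD f a κ _ _ (by omega) hsub1 (hnd.filter _)
          ?_ ?_).bind h.isProb (B' := sortCost D (m - 1 - κ)) ?_ le_rfl
        · intro c hc
          rw [List.mem_filter] at hc
          have h1 : p c = decide (τ c ≤ σ v) := hp c hc.1
          rw [hc.2, eq_comm, decide_eq_true_eq, Fin.le_def] at h1
          have := hlow c hc.1
          omega
        · intro c h1 h2
          have hc := hup c h1 (by omega)
          rw [List.mem_filter, hp c hc]
          refine ⟨hc, decide_eq_true ?_⟩
          rw [Fin.le_def]
          show (τ c : ℕ) ≤ σ v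
          omega
        intro L1 hL1
        refine (h.quicksortRows_meets hD0 hD f (a + κ + 1) (m - 1 - κ) _ _ (by omega) hsub2
          (hnd.filter _) ?_ ?_).bind h.isProb (B' := 0) ?_ (by simp)
        · intro c hc
          rw [List.mem_filter] at hc
          have h1 : p c = decide (τ c ≤ σ v) := hp c hc.1
          have h2 : p c = false := by simpa using hc.2
          rw [h2, eq_comm, decide_eq_false_iff_not, not_le, Fin.lt_def] at h1
          have := hlow c hc.1
          omega
        · intro c h1 h2
          have hc := hup c (by omega) (by omega)
          rw [List.mem_filter, hp c hc]
          refine ⟨hc, ?_⟩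
          rw [Bool.not_eq_true', decide_eq_false_iff_not, not_le, Fin.lt_def]
          show (σ v : ℕ) < τ c
          omega
        intro L2 hL2
        refine Alg.meets_ret ?_ le_rfl
        rw [List.map_append, List.map_cons, hL1, hL2, hκ, ← List.range'_succ,
          List.range'_append_1]
        congr 1
        omega
      refine ⟨(h.pick_sure _).bind fun k _ => (hbranch k).1, ?_⟩
      rw [h.pick_cost]
      have hm1 : ((rs.length + 1 : ℕ) : ℝ) + 1 = m := by
        rw [← hlen, hl]
        simp
      have hmpos : (0 : ℝ) < m := by
        have : 0 < m := by omega
        exact_mod_cast this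
      rw [hm1, div_le_iff₀ hmpos]
      have hsum := Finset.sum_le_sum (s := Finset.univ) fun (k : Fin l.length) _ => (hbranch k).2
      refine hsum.trans ?_
      -- A uniform position in the list is a uniform relative rank, and the two recursive terms have
      -- equal sums by reflection.
      rw [sum_fin_get l (fun i => g ((σ i : ℕ) - a)), sum_map_of_perm_range' hrows, hg]
      rw [Finset.sum_add_distrib, Finset.sum_add_distrib, Finset.sum_range_reflect]
      have hs : ∑ k ∈ Finset.range m, sortCost D k ≤
          ∑ k ∈ Finset.range m, 2 * D * ((k + 1) * (harmonic k : ℝ)) :=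
        Finset.sum_le_sum fun k _ => sortCost_le hD0 k
      have hh := sum_harmonic_le D hD0 m
      have hT : sortCost D m = 2 * D * ((m + 1) * harmonic m) := by
        rw [sortCost, if_neg (by omega)]
      rw [hT, Finset.sum_const, Finset.card_range, nsmul_eq_mul]
      nlinarith

end QuicksortAnalysis

/-! ### The learner and its cost in the two models -/

section Learner

variable {n : ℕ} {Q : QueryModel (Cell n)} {x y : Cell n → Bool} {ask : Cell n → Alg Q Bool}
  {pick : (k : ℕ) → Alg Q (Fin (k + 1))}
  {search : Finset (Cell n) → (Cell n → Bool) → Alg Q (Cell n)} {bound : ℝ → ℝ → ℝ}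

/-- The subroutines for the transposed matrix. -/
theorem QuicksortSpec.transpose (h : QuicksortSpec x x ask pick search bound) :
    QuicksortSpec x (fun z => x z.swap) (fun z => ask z.swap) pick
      (fun S p => do
        let z ← search (S.image Prod.swap) (fun z => p z.swap)
        pure z.swap) bound where
  isProb := h.isProb
  ask_meets z := h.ask_meets z.swap
  pick_sure := h.pick_sure
  pick_cost := h.pick_cost
  search_meets S p hS := by
    have hmem (z : Cell n) : z ∈ S.image Prod.swap ↔ z.swap ∈ S := by
      simp only [Finset.mem_image]
      constructor
      · rintro ⟨w, hw, rfl⟩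
        simpa using hw
      · exact fun hz => ⟨_, hz, Prod.swap_swap z⟩
    have hs := h.search_meets (S.image Prod.swap) (fun z => p z.swap) (by
      obtain ⟨z, hz, hne⟩ := hS
      exact ⟨z.swap, (hmem _).2 (by simpa using hz), by simpa using hne⟩)
    have hset : {z ∈ S.image Prod.swap | x z ≠ p z.swap} =
        ({z ∈ S | x z.swap ≠ p z}).image Prod.swap := by
      ext z
      simp only [Finset.mem_filter, hmem, Finset.mem_image]
      constructor
      · exact fun hz => ⟨z.swap, ⟨hz.1, by simpa using hz.2⟩, Prod.swap_swap z⟩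
      · rintro ⟨w, hw, rfl⟩
        simpa using hw
    rw [hset, Finset.card_image_of_injective _ Prod.swap_injective,
      Finset.card_image_of_injective _ Prod.swap_injective] at hs
    refine hs.bind h.isProb (B' := 0) ?_ (by simp)
    rintro z ⟨hz, hne⟩
    exact Alg.meets_ret ⟨(hmem z).1 hz, by simpa using hne⟩ le_rfl

theorem perm_map_finRange (σ : Equiv.Perm (Fin n)) :
    ((List.finRange n).map (fun i => (σ i : ℕ))).Perm (List.range' 0 n) := by
  rw [List.perm_ext_iff_of_nodup
    ((List.nodup_finRange n).map fun i j hij => σ.injective (Fin.ext hij)) List.nodup_range']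
  intro u
  simp only [List.mem_map, List.mem_finRange, true_and, List.mem_range'_1, zero_add, zero_le]
  constructor
  · rintro ⟨i, rfl⟩
    exact (σ i).2
  · intro hu
    exact ⟨σ.symm ⟨u, hu⟩, by simp⟩

theorem idxOf_eq_of_map_eq_range' {σ : Equiv.Perm (Fin n)} {L : List (Fin n)}
    (hL : L.map (fun i => (σ i : ℕ)) = List.range' 0 n) (i : Fin n) : L.idxOf i = σ i := by
  have hinj : Function.Injective (fun i => (σ i : ℕ)) := fun i j hij => σ.injective (Fin.ext hij)
  have hlen : L.length = n := by simpa using congrArg List.length hL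
  have hi : i ∈ L := by
    have : (σ i : ℕ) ∈ L.map (fun i => (σ i : ℕ)) := by
      rw [hL, List.mem_range'_1]
      have := (σ i).2
      omega
    obtain ⟨j, hj, he⟩ := List.mem_map.1 this
    rwa [← hinj he]
  have hlt := List.idxOf_lt_length_iff.2 hi
  have h1 : (L.map (fun i => (σ i : ℕ)))[L.idxOf i]'(by simpa using hlt) = σ i := by
    rw [List.getElem_map, List.getElem_idxOf]
  simp only [hL, List.getElem_range'] at h1
  omega

theorem QuicksortSpec.quicksortLearner_learns
    (h : ∀ x, QuicksortSpec x x ask pick search bound) {D : ℝ} (hD0 : 0 ≤ D)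
    (hD : ∀ m s k : ℕ, 2 ≤ m → m ≤ n → k < m → s ≤ m + 1 →
      (m : ℝ) + 1 + ∑ j ∈ (Finset.range m).erase k, bound s (j - k + (k - j) : ℕ) ≤ D * m) :
    LearnsInExpectation (quicksortLearner ask pick search) (halfGraphs n) (2 * sortCost D n) := by
  rintro M ⟨σ, τ, rfl⟩
  set M := (lowerTri n).submatrix σ τ with hM
  have hx := h (bits M)
  have hrow : QuicksortSpec (bits M) (fun z => decide (τ z.2 ≤ σ z.1)) ask pick search bound := hx
  have hcol := hx.transpose
  -- Transposing turns `τ c ≤ σ i` around; reversing both rank functions restores the shape required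
  -- of rows and columns.
  have hy : (fun z : Cell n => bits M z.swap) = fun z =>
      decide ((σ.trans Fin.revPerm) z.2 ≤ (τ.trans Fin.revPerm) z.1) := by
    ext z
    simp [bits, hM, lowerTri]
  rw [hy] at hcol
  have main : (quicksortLearner ask pick search).Meets (bits M) (fun N => N = M)
      (2 * sortCost D n) := by
    refine (hrow.quicksortRows_meets hD0 hD n 0 n _ _ le_rfl (perm_map_finRange σ)
      (List.nodup_finRange n) ?_ ?_).bind hx.isProb (B' := sortCost D n) ?_ (by linarith)
    · intro c _
      have := (τ c).2
      omega
    · simp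
    intro L hL
    refine (hcol.quicksortRows_meets hD0 hD n 0 n _ _ le_rfl
      (perm_map_finRange (τ.trans Fin.revPerm))
      (List.nodup_finRange n) ?_ ?_).bind hx.isProb (B' := 0) ?_ (by simp)
    · intro c _
      have := ((σ.trans Fin.revPerm) c).2
      omega
    · simp
    intro K hK
    refine Alg.meets_ret ?_ le_rfl
    ext i j
    -- Column `j` stands at position `n - 1 - τ j`, so `τ j ≤ σ i` reads `n ≤ σ i + (n - 1 - τ j) +
    -- 1`.
    rw [idxOf_eq_of_map_eq_range' hL, idxOf_eq_of_map_eq_range' hK]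
    simp only [hM, Matrix.submatrix_apply, lowerTri, Equiv.trans_apply, Fin.revPerm_apply,
      Fin.val_rev, decide_eq_decide, Fin.le_def]
    have := (σ i).2
    have := (τ j).2
    omega
  exact ⟨main.prob_eq_one hx.isProb, main.2⟩

theorem harmonic_le_two_mul_logb {n : ℕ} (hn : 2 ≤ n) :
    (harmonic n : ℝ) ≤ 2 * Real.logb 2 n := by
  have h1 := harmonic_le_one_add_log n
  have hn' : (2 : ℝ) ≤ n := by exact_mod_cast hn
  have hL : 1 ≤ Real.logb 2 n := by
    rw [Real.le_logb_iff_rpow_le (by norm_num) (by linarith)]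
    simpa using hn'
  have hlog : Real.log n ≤ Real.logb 2 n := by
    rw [Real.logb, le_div_iff₀ (Real.log_pos (by norm_num))]
    have h2 : Real.log 2 ≤ 1 := by linarith [Real.log_two_lt_d9]
    exact mul_le_of_le_one_right (Real.log_nonneg (by linarith)) h2
  linarith

theorem sortCost_le_logb {D : ℝ} (hD : 0 ≤ D) {n : ℕ} (hn : 1 ≤ n) :
    sortCost D n ≤ 8 * D * (n * Real.logb 2 n) := by
  have hn1 : (1 : ℝ) ≤ n := by exact_mod_cast hn
  have hL : 0 ≤ Real.logb 2 n := Real.logb_nonneg (by norm_num) hn1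
  rw [sortCost]
  split_ifs with h
  -- For `n = 1` the right side is 0, which is why `sortCost` has to vanish there.
  · positivity
  · have h1 := harmonic_le_two_mul_logb (n := n) (by omega)
    have h2 := harmonic_cast_nonneg n
    calc 2 * D * ((n + 1) * harmonic n) ≤ 2 * D * ((n + n) * (2 * Real.logb 2 n)) := by
          gcongr
      _ = 8 * D * (n * Real.logb 2 n) := by ring

/-- Summing a function of the distance to a point of an interval. -/
theorem sum_erase_dist_le (f : ℕ → ℝ) (hf : ∀ d, 0 ≤ f d) {m k : ℕ} (hk : k < m) :
    ∑ j ∈ (Finset.range m).erase k, f (j - k + (k - j)) ≤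
      2 * ∑ d ∈ Finset.range m, f (d + 1) := by
  rw [Finset.sum_erase_eq_sub (Finset.mem_range.2 hk)]
  obtain ⟨l, rfl⟩ := Nat.exists_eq_add_of_lt hk
  rw [add_assoc, Finset.sum_range_add, Finset.sum_range_succ' _ l]
  have h1 : ∑ j ∈ Finset.range k, f (j - k + (k - j)) = ∑ j ∈ Finset.range k, f (j + 1) := by
    rw [← Finset.sum_range_reflect]
    refine Finset.sum_congr rfl fun j hj => ?_
    rw [Finset.mem_range] at hj
    congr 1
    omega
  have h2 : ∑ j ∈ Finset.range l, f (k + (j + 1) - k + (k - (k + (j + 1)))) =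
      ∑ j ∈ Finset.range l, f (j + 1) :=
    Finset.sum_congr rfl fun j _ => by congr 1; omega
  have h3 (a : ℕ) (ha : a ≤ k + (l + 1)) : ∑ j ∈ Finset.range a, f (j + 1) ≤
      ∑ j ∈ Finset.range (k + (l + 1)), f (j + 1) :=
    Finset.sum_le_sum_of_subset_of_nonneg (Finset.range_mono ha) fun _ _ _ => hf _
  rw [h1, h2]
  simp only [add_zero]
  linarith [h3 k (by omega), h3 l (by omega)]

/-- Telescoping: `1 / √(m + 1) ≤ 2 (√(m + 1) - √m)`. -/
theorem sum_inv_sqrt_le (m : ℕ) :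
    ∑ d ∈ Finset.range m, 1 / Real.sqrt ((d + 1 : ℕ) : ℝ) ≤ 2 * Real.sqrt m := by
  induction m with
  | zero => simp
  | succ m ih =>
    rw [Finset.sum_range_succ]
    have ha : 0 ≤ Real.sqrt (m : ℝ) := Real.sqrt_nonneg _
    have hb : 0 < Real.sqrt ((m + 1 : ℕ) : ℝ) := Real.sqrt_pos.2 (by positivity)
    have ha2 := Real.sq_sqrt (Nat.cast_nonneg m : (0 : ℝ) ≤ m)
    have hb2 := Real.sq_sqrt (Nat.cast_nonneg (m + 1) : (0 : ℝ) ≤ ((m + 1 : ℕ) : ℝ))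
    have h : 1 / Real.sqrt ((m + 1 : ℕ) : ℝ) ≤
        2 * (Real.sqrt ((m + 1 : ℕ) : ℝ) - Real.sqrt m) := by
      rw [div_le_iff₀ hb]
      push_cast at hb2 ⊢
      nlinarith [sq_nonneg (Real.sqrt ((m : ℝ) + 1) - Real.sqrt m)]
    linarith

theorem randomized_pivot_cost (m s k : ℕ) (hm : 2 ≤ m) (hmn : m ≤ n) (hk : k < m)
    (hs : s ≤ m + 1) :
    (m : ℝ) + 1 + ∑ j ∈ (Finset.range m).erase k, (s : ℝ) / (j - k + (k - j) : ℕ) ≤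
      10 * Real.logb 2 n * m := by
  have h1 := sum_erase_dist_le (fun d => (s : ℝ) / d) (fun d => by positivity) hk
  have h2 : ∑ d ∈ Finset.range m, (s : ℝ) / ((d + 1 : ℕ) : ℝ) = s * harmonic m := by
    rw [harmonic]
    push_cast
    rw [Finset.mul_sum]
    rfl
  rw [h2] at h1
  have h3 := harmonic_le_two_mul_logb hm
  have hm' : (2 : ℝ) ≤ m := by exact_mod_cast hm
  have hn' : (m : ℝ) ≤ n := by exact_mod_cast hmn
  have h4 : Real.logb 2 m ≤ Real.logb 2 n :=
    Real.logb_le_logb_of_le (by norm_num) (by linarith) hn'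
  have hL : 1 ≤ Real.logb 2 n := by
    rw [Real.le_logb_iff_rpow_le (by norm_num) (by linarith)]
    simpa using hm'.trans hn'
  have hs' : (s : ℝ) ≤ m + 1 := by exact_mod_cast hs
  have h5 : (s : ℝ) * harmonic m ≤ (m + 1) * (2 * Real.logb 2 n) :=
    mul_le_mul hs' (by linarith) (harmonic_cast_nonneg m) (by linarith)
  nlinarith

/-- The square root removes the logarithm: `√s ∑ 1 / √d ≤ 2√m * 2√m = 4 m`. Each distance counts at
most twice, so the searches cost at most `2 * 54 * 4 m = 432 m`, and reading the pivot at most `m +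
1`. -/
theorem quantum_pivot_cost (m s k : ℕ) (hm : 2 ≤ m) (hk : k < m)
    (hs : s ≤ m + 1) :
    (m : ℝ) + 1 + ∑ j ∈ (Finset.range m).erase k, 54 * Real.sqrt ((s : ℝ) / (j - k + (k - j) : ℕ)) ≤
      434 * m := by
  have h1 := sum_erase_dist_le (fun d => 54 * Real.sqrt ((s : ℝ) / d)) (fun d => by positivity) hk
  have h2 : ∑ d ∈ Finset.range m, 54 * Real.sqrt ((s : ℝ) / ((d + 1 : ℕ) : ℝ)) =
      54 * Real.sqrt s * ∑ d ∈ Finset.range m, 1 / Real.sqrt ((d + 1 : ℕ) : ℝ) := by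
    rw [Finset.mul_sum]
    refine Finset.sum_congr rfl fun d _ => ?_
    rw [Real.sqrt_div (Nat.cast_nonneg s)]
    ring
  rw [h2] at h1
  have h3 := sum_inv_sqrt_le m
  have hm' : (2 : ℝ) ≤ m := by exact_mod_cast hm
  have hs' : (s : ℝ) ≤ m + 1 := by exact_mod_cast hs
  have h4 : Real.sqrt s ≤ 2 * Real.sqrt m := by
    rw [Real.sqrt_le_left (by positivity), mul_pow, Real.sq_sqrt (by positivity)]
    linarith
  have h5 : Real.sqrt s * ∑ d ∈ Finset.range m, 1 / Real.sqrt ((d + 1 : ℕ) : ℝ) ≤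
      2 * Real.sqrt m * (2 * Real.sqrt m) :=
    mul_le_mul h4 h3 (Finset.sum_nonneg fun _ _ => by positivity) (by positivity)
  have h6 := Real.mul_self_sqrt (Nat.cast_nonneg m : (0 : ℝ) ≤ m)
  nlinarith

theorem IsSearch.mono {I : Type} {Q : QueryModel I} {search : Finset I → (I → Bool) → Alg Q I}
    {b b' : ℝ → ℝ → ℝ} (h : IsSearch search b) (hb : ∀ s d : ℕ, b s d ≤ b' s d) :
    IsSearch search b' := fun x S p hS =>
  ⟨(h x S p hS).1, (h x S p hS).2.trans (hb _ _)⟩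

theorem IsSearch.meets {I : Type} {Q : QueryModel I} {search : Finset I → (I → Bool) → Alg Q I}
    {b : ℝ → ℝ → ℝ} (h : IsSearch search b) {x : I → Bool} (hQ : Q.IsProb x) (S : Finset I)
    (p : I → Bool) (hS : ∃ i ∈ S, x i ≠ p i) :
    (search S p).Meets x (fun i => i ∈ S ∧ x i ≠ p i) (b S.card {i ∈ S | x i ≠ p i}.card) :=
  ⟨(Alg.prob_eq_one_iff hQ _ _).1 (h x S p hS).1, (h x S p hS).2⟩

theorem LearnsInExpectation.mono {A : Alg Q (Matrix (Fin n) (Fin n) Bool)}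
    {F : Set (Matrix (Fin n) (Fin n) Bool)} {B B' : ℝ} (h : LearnsInExpectation A F B)
    (hB : B ≤ B') : LearnsInExpectation A F B' := fun M hM =>
  ⟨(h M hM).1, (h M hM).2.trans hB⟩

variable [NeZero n]

theorem quicksortSpec_randomized (x : Cell n → Bool) :
    QuicksortSpec x x randAsk randPick randSearch (fun s d => s / d) where
  isProb := randomized.isProb x
  ask_meets := randomized.meets_ask x
  pick_sure := randomized.sure_pick x
  pick_cost := randomized.expCost_pick_bind x
  search_meets := randSearch_isSearch.meets (randomized.isProb x)

theorem quicksortSpec_quantum (x : Cell n → Bool) :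
    QuicksortSpec x x quantAsk quantPick quantSearch (fun s d => 54 * Real.sqrt (s / d)) where
  isProb := quantum.isProb x
  ask_meets := quantum.meets_ask x
  pick_sure := quantum.sure_pick x
  pick_cost := quantum.expCost_pick_bind x
  search_meets := quantSearch_isSearch.meets (quantum.isProb x)

theorem randomized_learner :
    ∃ search : Finset (Cell n) → (Cell n → Bool) → Alg (randomized (Cell n)) (Cell n),
      IsSearch search (fun s d => 160 * (s / d)) ∧
      LearnsInExpectation (quicksortLearner randAsk randPick search) (halfGraphs n)
        (160 * (n * Real.logb 2 n ^ 2)) := by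
  refine ⟨randSearch, randSearch_isSearch.mono fun s d => ?_, ?_⟩
  · have : (0 : ℝ) ≤ s / d := by positivity
    linarith
  · have hn : 1 ≤ n := NeZero.one_le
    have hL : 0 ≤ Real.logb 2 n := Real.logb_nonneg (by norm_num) (by exact_mod_cast hn)
    have hD : 0 ≤ 10 * Real.logb 2 n := by positivity
    -- `160 = 2 * 8 * 10`: two sorts, the factor 8 of `sortCost_le_logb`, and `D = 10 log n`.
    refine (QuicksortSpec.quicksortLearner_learns quicksortSpec_randomized hD
      randomized_pivot_cost).mono ?_
    have := sortCost_le_logb hD hn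
    nlinarith

theorem quantum_learner :
    ∃ search : Finset (Cell n) → (Cell n → Bool) → Alg (quantum (Cell n)) (Cell n),
      IsSearch search (fun s d => 6944 * Real.sqrt (s / d)) ∧
      LearnsInExpectation (quicksortLearner quantAsk quantPick search) (halfGraphs n)
        (6944 * (n * Real.logb 2 n)) := by
  refine ⟨quantSearch, quantSearch_isSearch.mono fun s d => ?_, ?_⟩
  · have := Real.sqrt_nonneg ((s : ℝ) / d)
    linarith
  · refine (QuicksortSpec.quicksortLearner_learns quicksortSpec_quantum (D := 434) (by norm_num)
      fun m s k hm _ hk hs => quantum_pivot_cost m s k hm hk hs).mono ?_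
    have := sortCost_le_logb (D := 434) (by norm_num) (NeZero.one_le (n := n))
    linarith

end Learner

/-! ### Change of an inner product under one query -/

section Progress

variable {I : Type} {w : ℕ}

/-- The squared norm of the part of a state that queries position `i`. -/
def queryWeight (φ : QBasis I w → ℂ) (i : I) : ℝ := ∑ y : Bool × Fin w, ‖φ (i, y)‖ ^ 2

theorem queryWeight_nonneg (φ : QBasis I w → ℂ) (i : I) : 0 ≤ queryWeight φ i :=
  Finset.sum_nonneg fun _ _ => sq_nonneg _

theorem abs_re_star_mul_le (a b : ℂ) {r : ℝ} (hr : 0 < r) :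
    |(star a * b).re| ≤ (r * ‖a‖ ^ 2 + r⁻¹ * ‖b‖ ^ 2) / 2 := by
  refine (Complex.abs_re_le_norm _).trans ?_
  rw [norm_mul, norm_star]
  have h : r * ‖a‖ ^ 2 + r⁻¹ * ‖b‖ ^ 2 - 2 * (‖a‖ * ‖b‖) = r⁻¹ * (r * ‖a‖ - ‖b‖) ^ 2 := by
    field_simp
    ring
  have : 0 ≤ r⁻¹ * (r * ‖a‖ - ‖b‖) ^ 2 := by positivity
  linarith

/-- The permutation of the answer and work registers performed by a query with answer `b`. -/
def answerEquiv (b : Bool) : Equiv.Perm (Bool × Fin w) where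
  toFun y := (xor y.1 b, y.2)
  invFun y := (xor y.1 b, y.2)
  left_inv y := by simp
  right_inv y := by simp

theorem queryWeight_oracle (x : I → Bool) (φ : QBasis I w → ℂ) (i : I) :
    queryWeight (oracle x φ) i = queryWeight φ i :=
  Equiv.sum_comp (answerEquiv (x i)) (fun y => ‖φ (i, y)‖ ^ 2)

variable [Fintype I]

theorem sum_queryWeight (φ : QBasis I w → ℂ) : ∑ i, queryWeight φ i = ∑ z, ‖φ z‖ ^ 2 := by
  rw [Fintype.sum_prod_type]
  rfl

/-- A query changes the inner product of two states only through the positions at which the two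
inputs differ. -/
theorem re_dotProduct_sub_oracle_le (x y : I → Bool) (φ ψ : QBasis I w → ℂ) (r : I → ℝ)
    (hr : ∀ i, x i ≠ y i → 0 < r i) :
    (star φ ⬝ᵥ ψ).re - (star (oracle x φ) ⬝ᵥ oracle y ψ).re ≤
      ∑ i, if x i ≠ y i then r i * queryWeight φ i + (r i)⁻¹ * queryWeight ψ i else 0 := by
  have hre (φ ψ : QBasis I w → ℂ) : (star φ ⬝ᵥ ψ).re =
      ∑ i, ∑ y : Bool × Fin w, (star (φ (i, y)) * ψ (i, y)).re := by
    rw [dotProduct, Complex.re_sum, Fintype.sum_prod_type]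
    rfl
  rw [hre, hre, ← Finset.sum_sub_distrib]
  refine Finset.sum_le_sum fun i _ => ?_
  split_ifs with hi
  · have habs (φ ψ : QBasis I w → ℂ) :
        |∑ y : Bool × Fin w, (star (φ (i, y)) * ψ (i, y)).re| ≤
        (r i * queryWeight φ i + (r i)⁻¹ * queryWeight ψ i) / 2 := by
      refine (Finset.abs_sum_le_sum_abs _ _).trans ?_
      refine (Finset.sum_le_sum fun y _ => abs_re_star_mul_le _ _ (hr i hi)).trans_eq ?_
      rw [← Finset.sum_div, Finset.sum_add_distrib, ← Finset.mul_sum, ← Finset.mul_sum]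
      rfl
    -- The inner products before and after the query each account for half of the bound; a query
    -- only permutes the answer register and so keeps the query weights.
    have h1 := abs_le.1 (habs φ ψ)
    have h2 := abs_le.1 (habs (oracle x φ) (oracle y ψ))
    rw [queryWeight_oracle, queryWeight_oracle] at h2
    linarith
  · rw [not_not] at hi
    have : ∑ z : Bool × Fin w, (star (oracle x φ (i, z)) * oracle y ψ (i, z)).re =
        ∑ z : Bool × Fin w, (star (φ (i, z)) * ψ (i, z)).re := by
      rw [← Equiv.sum_comp (answerEquiv (x i)) (fun z => (star (φ (i, z)) * ψ (i, z)).re)]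
      refine Finset.sum_congr rfl fun z _ => ?_
      show (star (φ (i, xor z.1 (x i), z.2)) * ψ (i, xor z.1 (y i), z.2)).re = _
      rw [← hi]
      rfl
    rw [this, sub_self]

end Progress

/-! ### Distinguishable final states -/

section FinalState

variable {I : Type} [Fintype I] [DecidableEq I] {R : Type}

theorem QCircuit.re_dotProduct_zero (c : QCircuit I) (x y : I → Bool) :
    (star (c.state x 0) ⬝ᵥ c.state y 0).re = 1 := by
  have h : c.state y 0 = c.state x 0 := rfl
  have h1 := sum_norm_sq_eq_star_dotProduct (c.state x 0)
  rw [c.sum_norm_sq_state] at h1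
  rw [h, ← h1, Complex.ofReal_re]

theorem QCircuit.re_dotProduct_succ (c : QCircuit I) (x y : I → Bool) (t : ℕ) :
    (star (c.state x (t + 1)) ⬝ᵥ c.state y (t + 1)).re =
      (star (oracle x (c.state x t)) ⬝ᵥ oracle y (c.state y t)).re := by
  rw [QCircuit.state, QCircuit.state, star_dotProduct_unitary]

open Classical in
/-- The final states on two inputs that are told apart are far from parallel. -/
theorem QCircuit.re_dotProduct_final_le (c : QCircuit I) (out : QBasis I c.w → R)
    {x y : I → Bool} {a b : R} (hab : a ≠ b) (ha : 2 / 3 ≤ c.outProb out x a)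
    (hb : 2 / 3 ≤ c.outProb out y b) :
    (star (c.state x c.T) ⬝ᵥ c.state y c.T).re ≤ 17 / 18 := by
  set φ := c.state x c.T with hφ
  set ψ := c.state y c.T with hψ
  have hx : ∑ z, ‖φ z‖ ^ 2 = 1 := c.sum_norm_sq_state x c.T
  have hy : ∑ z, ‖ψ z‖ ^ 2 = 1 := c.sum_norm_sq_state y c.T
  have hA : 2 / 3 ≤ ∑ z, if out z = a then ‖φ z‖ ^ 2 else 0 := by
    refine ha.trans_eq (Finset.sum_congr rfl fun z _ => ?_)
    congr
  have hB : 2 / 3 ≤ ∑ z, if out z = b then ‖ψ z‖ ^ 2 else 0 := by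
    refine hb.trans_eq (Finset.sum_congr rfl fun z _ => ?_)
    congr
  have hC : (∑ z, if out z = a then ‖ψ z‖ ^ 2 else 0) +
      (∑ z, if out z = b then ‖ψ z‖ ^ 2 else 0) ≤ 1 := by
    rw [← hy, ← Finset.sum_add_distrib]
    refine Finset.sum_le_sum fun z _ => ?_
    have := sq_nonneg ‖ψ z‖
    split_ifs with h1 h2
    · exact absurd (h1.symm.trans h2) hab
    all_goals linarith
  -- Arithmetic–geometric mean inequality with ratio 2/3 where the output is `a` and 3/2 elsewhere.
  -- The masses on `a` are at least 2/3 for `φ` and at most 1/3 for `ψ`, so the sum is at most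
  -- `13/12 - 5/12 * 1/3 = 17/18`.
  have hterm (z) : (star (φ z) * ψ z).re ≤
      3 / 4 * ‖φ z‖ ^ 2 + 1 / 3 * ‖ψ z‖ ^ 2 - 5 / 12 * (if out z = a then ‖φ z‖ ^ 2 else 0) +
        5 / 12 * (if out z = a then ‖ψ z‖ ^ 2 else 0) := by
    split_ifs
    · have := (le_abs_self _).trans
        (abs_re_star_mul_le (φ z) (ψ z) (r := 2 / 3) (by norm_num))
      norm_num at this ⊢
      linarith
    · have := (le_abs_self _).trans
        (abs_re_star_mul_le (φ z) (ψ z) (r := 3 / 2) (by norm_num))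
      norm_num at this ⊢
      linarith
  have hsum := Finset.sum_le_sum (s := Finset.univ) fun z _ => hterm z
  rw [Finset.sum_add_distrib, Finset.sum_sub_distrib, Finset.sum_add_distrib, ← Finset.mul_sum,
    ← Finset.mul_sum, ← Finset.mul_sum, ← Finset.mul_sum, hx, hy] at hsum
  have hre : (star φ ⬝ᵥ ψ).re = ∑ z, (star (φ z) * ψ z).re := by
    rw [dotProduct, Complex.re_sum]
    rfl
  rw [hre]
  linarith

end FinalState

/-! ### Kernel sums and inverse distances -/

section HilbertKernel

/-- The Hilbert kernel `1 / (P + q)` with the weights of the Schur test. -/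
def schurKernel (P q : ℕ) : ℝ := 1 / ((P : ℝ) + q) * Real.sqrt (P / (q + 1))

theorem schurKernel_nonneg (P q : ℕ) : 0 ≤ schurKernel P q := by
  unfold schurKernel
  positivity

/-- A discrete form of the convergent integral of `√(P / q) / (P + q)`. The partial sums are
dominated by the telescoping bound `8 √N / (√P + √N)`, whose increments are computed from `√(q + 1)
- √q = 1 / (√(q + 1) + √q)`. -/
theorem sum_schurKernel_le {P : ℕ} (hP : 1 ≤ P) (N : ℕ) :
    ∑ q ∈ Finset.range N, schurKernel P q ≤ 8 := by
  have hP' : (1 : ℝ) ≤ P := by exact_mod_cast hP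
  set s := Real.sqrt P with hs
  have hs2 : s ^ 2 = P := Real.sq_sqrt (by linarith)
  have hs0 : 0 < s := Real.sqrt_pos.2 (by linarith)
  have key : ∑ q ∈ Finset.range N, schurKernel P q ≤ 8 * (Real.sqrt N / (s + Real.sqrt N)) := by
    induction N with
    | zero => simp
    | succ q ih =>
      rw [Finset.sum_range_succ]
      have hstep : schurKernel P q ≤ 8 * (Real.sqrt ((q + 1 : ℕ) : ℝ) /
          (s + Real.sqrt ((q + 1 : ℕ) : ℝ))) - 8 * (Real.sqrt q / (s + Real.sqrt q)) := by
        rw [schurKernel, Real.sqrt_div (by linarith), ← hs, ← Nat.cast_succ]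
        have ha2 : Real.sqrt (q : ℝ) ^ 2 = q := Real.sq_sqrt (Nat.cast_nonneg q)
        have hb2 : Real.sqrt ((q + 1 : ℕ) : ℝ) ^ 2 = q + 1 := by
          rw [Real.sq_sqrt (by positivity)]
          push_cast
          ring
        have ha : 0 ≤ Real.sqrt (q : ℝ) := Real.sqrt_nonneg _
        have hb : 0 < Real.sqrt ((q + 1 : ℕ) : ℝ) := Real.sqrt_pos.2 (by positivity)
        show 1 / ((P : ℝ) + q) * (s / Real.sqrt ((q + 1 : ℕ) : ℝ)) ≤ _
        have hPq : (P : ℝ) + q = s ^ 2 + Real.sqrt (q : ℝ) ^ 2 := by rw [hs2, ha2]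
        rw [hPq]
        set a := Real.sqrt (q : ℝ)
        set b := Real.sqrt ((q + 1 : ℕ) : ℝ)
        have hab : (b - a) * (a + b) = 1 := by linear_combination hb2 - ha2
        have hle : a ≤ b := by
          by_contra hcon
          nlinarith
        have e : 8 * (b / (s + b)) - 8 * (a / (s + a)) =
            8 * s / ((a + b) * ((s + a) * (s + b))) := by
          field_simp
          linear_combination s * hab
        have hs1 : 1 ≤ s ^ 2 := by rw [hs2]; exact hP'
        have h1 : (s + a) * (s + b) ≤ 4 * (s ^ 2 + a ^ 2) := by
          nlinarith [sq_nonneg (s - b), sq_nonneg (s - a), sq_nonneg (a - b)]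
        have h2 : (a + b) * ((s + a) * (s + b)) ≤ 2 * b * (4 * (s ^ 2 + a ^ 2)) :=
          mul_le_mul (by linarith) h1 (by positivity) (by positivity)
        rw [e, div_mul_div_comm, one_mul, div_le_div_iff₀ (by positivity) (by positivity)]
        nlinarith
      linarith
  refine key.trans ?_
  have : Real.sqrt N / (s + Real.sqrt N) ≤ 1 :=
    (div_le_one (by positivity)).2 (by linarith)
  linarith

theorem sum_schurKernel_comp_le {ι : Type} [Fintype ι] {P : ℕ} (hP : 1 ≤ P) (p : ι → Prop)
    [DecidablePred p] (e : ι → ℕ) (he : ∀ i j, p i → p j → e i = e j → i = j) :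
    (∑ i, if p i then schurKernel P (e i) else 0) ≤ 8 := by
  rw [← Finset.sum_filter]
  have hinj : Set.InjOn e ({i | p i} : Finset ι) := fun i hi j hj h =>
    he i j (by simpa using hi) (by simpa using hj) h
  rw [← Finset.sum_image (f := fun q => schurKernel P q) hinj]
  obtain ⟨N, hN⟩ := Finset.exists_nat_subset_range (Finset.image e ({i | p i} : Finset ι))
  exact (Finset.sum_le_sum_of_subset_of_nonneg hN fun q _ _ => schurKernel_nonneg P q).trans
    (sum_schurKernel_le hP N)

theorem half_mul_log_le_sum_log (n : ℕ) :
    (n : ℝ) / 2 * Real.log n ≤ ∑ j ∈ Finset.range n, Real.log (j + 1) := by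
  -- Pair `j + 1` with `n - j`: their product is at least `n`.
  have h : ∑ _j ∈ Finset.range n, Real.log n ≤
      ∑ j ∈ Finset.range n, (Real.log (j + 1) + Real.log ((n - 1 - j : ℕ) + 1)) := by
    refine Finset.sum_le_sum fun j hj => ?_
    rw [Finset.mem_range] at hj
    obtain ⟨l, rfl⟩ := Nat.exists_eq_add_of_lt hj
    rw [← Real.log_mul (by positivity) (by positivity)]
    refine Real.log_le_log (by positivity) ?_
    rw [show j + l + 1 - 1 - j = l by omega]
    push_cast
    nlinarith [(by positivity : (0 : ℝ) ≤ (j : ℝ) * l)]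
  rw [Finset.sum_add_distrib,
    Finset.sum_range_reflect (fun j => Real.log ((j : ℝ) + 1)) n, Finset.sum_const,
    Finset.card_range, nsmul_eq_mul] at h
  linarith

/-- The sum of the inverse distances of the pairs of ranks. -/
def inverseDistanceSum (n : ℕ) : ℝ :=
  ∑ k : Fin n, ∑ m : Fin n, if k < m then 1 / ((m : ℝ) - k) else 0

/-- For fixed `m` the inverse distances to the smaller ranks add up to the harmonic number of `m`,
which is at least `log (m + 1)`. -/
theorem half_mul_log_le_inverseDistanceSum (n : ℕ) :
    (n : ℝ) / 2 * Real.log n ≤ inverseDistanceSum n := by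
  refine (half_mul_log_le_sum_log n).trans ?_
  rw [inverseDistanceSum, Finset.sum_comm, Finset.sum_range]
  refine Finset.sum_le_sum fun m _ => ?_
  have h := log_add_one_le_harmonic (m : ℕ)
  push_cast at h
  refine h.trans_eq ?_
  have h1 : ∑ k : Fin n, (if k < m then 1 / ((m : ℝ) - k) else 0) =
      ∑ k ∈ Finset.range n, if k < (m : ℕ) then 1 / (((m : ℕ) : ℝ) - k) else 0 := by
    rw [Finset.sum_range]
    rfl
  rw [h1, ← Finset.sum_filter]
  have h2 : (Finset.range n).filter (fun k => k < (m : ℕ)) = Finset.range m := by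
    ext k
    simp only [Finset.mem_filter, Finset.mem_range]
    have := m.2
    omega
  rw [h2, ← Finset.sum_range_reflect, harmonic]
  push_cast
  refine Finset.sum_congr rfl fun k hk => ?_
  rw [Finset.mem_range] at hk
  rw [Nat.cast_sub (by omega), Nat.cast_sub (by omega), one_div]
  congr 1
  push_cast
  ring

end HilbertKernel

/-! ### Neighbouring orders and the Schur test -/

section MovedRank

variable {n : ℕ}

theorem cycleIcc_val {k m : Fin n} (hkm : k ≤ m) (r : Fin n) :
    (Fin.cycleIcc k m r : ℕ) =
      if r < k ∨ m < r then (r : ℕ) else if r = m then (k : ℕ) else (r : ℕ) + 1 := by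
  have : NeZero n := ⟨fun h => by subst h; exact k.elim0⟩
  split_ifs with h1 h2
  · rcases h1 with h1 | h1
    · rw [Fin.cycleIcc_of_lt h1]
    · rw [Fin.cycleIcc_of_gt h1]
  · rw [h2, Fin.cycleIcc_of_last hkm]
  · rw [not_or, not_lt, not_lt] at h1
    have hlt : r < m := lt_of_le_of_ne h1.2 h2
    rw [Fin.cycleIcc_of_ge_of_lt h1.1 hlt]
    exact Fin.val_add_one_of_lt' (by have := m.2; rw [Fin.lt_def] at hlt; omega)

/-- The comparison matrix of an order, which is a half graph. -/
def comparison (σ : Equiv.Perm (Fin n)) : Matrix (Fin n) (Fin n) Bool :=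
  (lowerTri n).submatrix σ σ

theorem comparison_mem (σ : Equiv.Perm (Fin n)) : comparison σ ∈ halfGraphs n := ⟨σ, σ, rfl⟩

theorem bits_comparison (σ : Equiv.Perm (Fin n)) (z : Cell n) :
    bits (comparison σ) z = decide (σ z.2 ≤ σ z.1) := rfl

/-- Moving rank `m` down to rank `k` changes only the comparisons between the moved element and
those it passes. -/
theorem comparison_differ {k m : Fin n} (hkm : k < m) (σ : Equiv.Perm (Fin n)) (u v : Fin n)
    (h : bits (comparison σ) (σ.symm u, σ.symm v) ≠
      bits (comparison (Fin.cycleIcc k m * σ)) (σ.symm u, σ.symm v)) :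
    (u = m ∧ k ≤ v ∧ v < m) ∨ (v = m ∧ k ≤ u ∧ u < m) := by
  simp only [bits_comparison, Equiv.Perm.mul_apply, Equiv.apply_symm_apply, Ne,
    decide_eq_decide, Fin.le_def, cycleIcc_val hkm.le] at h
  simp only [Fin.lt_def, Fin.le_def, Fin.ext_iff] at h hkm ⊢
  split_ifs at h <;> omega

theorem comparison_ne {k m : Fin n} (hkm : k < m) (σ : Equiv.Perm (Fin n)) :
    comparison σ ≠ comparison (Fin.cycleIcc k m * σ) := by
  intro h
  -- The comparison of the elements of ranks `k` and `m` is reversed by the move.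
  have h1 := congrFun (congrArg bits h) (σ.symm k, σ.symm m)
  simp only [bits_comparison, Equiv.Perm.mul_apply, Equiv.apply_symm_apply,
    decide_eq_decide, Fin.le_def, cycleIcc_val hkm.le] at h1
  simp only [Fin.lt_def, Fin.ext_iff] at h1 hkm
  split_ifs at h1 <;> omega

/-- A sum over the positions at which two neighbouring comparison matrices differ. -/
theorem sum_differ_le {k m : Fin n} (hkm : k < m) (σ : Equiv.Perm (Fin n)) (F : Cell n → ℝ)
    (hF : ∀ z, 0 ≤ F z) :
    (∑ z, if bits (comparison σ) z ≠ bits (comparison (Fin.cycleIcc k m * σ)) z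
      then F z else 0) ≤
    ∑ l : Fin n, if k ≤ l ∧ l < m then
      F (σ.symm m, σ.symm l) + F (σ.symm l, σ.symm m) else 0 := by
  rw [← Equiv.sum_comp (Equiv.prodCongr σ.symm σ.symm), Fintype.sum_prod_type]
  have h : ∀ u v : Fin n, (if bits (comparison σ) (σ.symm u, σ.symm v) ≠
      bits (comparison (Fin.cycleIcc k m * σ)) (σ.symm u, σ.symm v)
      then F (σ.symm u, σ.symm v) else 0) ≤
      (if u = m then (if k ≤ v ∧ v < m then F (σ.symm u, σ.symm v) else 0) else 0) +
      (if v = m then (if k ≤ u ∧ u < m then F (σ.symm u, σ.symm v) else 0) else 0) := by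
    intro u v
    have h0 := hF (σ.symm u, σ.symm v)
    by_cases hd : bits (comparison σ) (σ.symm u, σ.symm v) ≠
      bits (comparison (Fin.cycleIcc k m * σ)) (σ.symm u, σ.symm v)
    · rw [if_pos hd]
      rcases comparison_differ hkm σ u v hd with ⟨h1, h2⟩ | ⟨h1, h2⟩
      · rw [if_pos h1, if_pos h2]
        split_ifs <;> linarith
      · rw [if_pos h1, if_pos h2]
        split_ifs <;> linarith
    · rw [if_neg hd]
      split_ifs <;> linarith
  refine (Finset.sum_le_sum fun u _ => Finset.sum_le_sum fun v _ => h u v).trans_eq ?_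
  simp only [Finset.sum_add_distrib, Finset.sum_ite_eq', Finset.mem_univ, if_true]
  rw [Finset.sum_comm, ← Finset.sum_add_distrib]
  simp only [Finset.sum_ite_eq', Finset.mem_univ, if_true]
  refine Finset.sum_congr rfl fun l _ => ?_
  split_ifs <;> simp

/-- The ratio of the weights in the Schur test. -/
def schurRatio (k m l : Fin n) : ℝ :=
  Real.sqrt (((m - l : ℕ) : ℝ) / ((l - k : ℕ) + 1))

theorem schurRatio_nonneg (k m l : Fin n) : 0 ≤ schurRatio k m l := Real.sqrt_nonneg _

theorem schurRatio_pos {k m l : Fin n} (hlm : l < m) : 0 < schurRatio k m l := by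
  have : 0 < (m : ℕ) - l := by
    rw [Fin.lt_def] at hlm
    omega
  unfold schurRatio
  positivity

/-- The Schur test for the Hilbert kernel, summed over all orders. -/
theorem schur_test (G : Equiv.Perm (Fin n) → Fin n → Fin n → ℝ) (hG : ∀ σ u v, 0 ≤ G σ u v) :
    ∑ σ : Equiv.Perm (Fin n), ∑ k : Fin n, ∑ m : Fin n,
      (if k < m then 1 / ((m : ℝ) - k) * ∑ l : Fin n, (if k ≤ l ∧ l < m then
      schurRatio k m l * G σ m l +
        (schurRatio k m l)⁻¹ * G (Fin.cycleIcc k m * σ) k (Fin.cycleIcc k m l) else 0) else 0) ≤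
    16 * ∑ σ : Equiv.Perm (Fin n), ∑ u, ∑ v : Fin n, G σ u v := by
  have hterm (σ : Equiv.Perm (Fin n)) (k m : Fin n) :
      (if k < m then 1 / ((m : ℝ) - k) * ∑ l : Fin n, (if k ≤ l ∧ l < m then
        schurRatio k m l * G σ m l +
        (schurRatio k m l)⁻¹ * G (Fin.cycleIcc k m * σ) k (Fin.cycleIcc k m l) else 0) else 0) ≤
      (∑ l : Fin n, if k ≤ l ∧ l < m then schurKernel (m - l) (l - k) * G σ m l else 0) +
      ∑ v : Fin n, if k < v ∧ v ≤ m then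
        schurKernel (v - k) (m - v) * G (Fin.cycleIcc k m * σ) k v else 0 := by
    split_ifs with hkm
    -- A passed element of rank `l` has rank `v = l + 1` in the neighbouring order, where the moved
    -- one has rank `k`. With `(P, q) = (m - l, l - k)` on one side and `(v - k, m - v)` on the
    -- other, both coefficients become the same kernel.
    · rw [← Equiv.sum_comp (Fin.cycleIcc k m) (fun v : Fin n => if k < v ∧ v ≤ m then
        schurKernel (v - k) (m - v) * G (Fin.cycleIcc k m * σ) k v else 0),
        ← Finset.sum_add_distrib, Finset.mul_sum]
      refine Finset.sum_le_sum fun l _ => ?_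
      by_cases hl : k ≤ l ∧ l < m
      · rw [if_pos hl, if_pos hl]
        obtain ⟨hkl, hlm⟩ := hl
        have hc : (Fin.cycleIcc k m l : ℕ) = l + 1 := by
          rw [cycleIcc_val hkm.le, if_neg (by simp [not_lt, hkl, hlm.le]), if_neg hlm.ne]
        have hkl' : (k : ℕ) ≤ l := hkl
        have hlm' : (l : ℕ) < m := hlm
        rw [if_pos (by rw [Fin.lt_def, Fin.le_def, hc]; omega), hc, mul_add]
        have hsub : ((m - l : ℕ) : ℝ) = m - l := Nat.cast_sub hlm'.le
        have hsub2 : ((l - k : ℕ) : ℝ) = l - k := Nat.cast_sub hkl'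
        have e1 : 1 / ((m : ℝ) - k) * schurRatio k m l = schurKernel (m - l) (l - k) := by
          rw [schurKernel, schurRatio, hsub, hsub2]
          congr 2
          ring
        have e2 : 1 / ((m : ℝ) - k) * (schurRatio k m l)⁻¹ =
            schurKernel (l + 1 - k) (m - (l + 1)) := by
          have h1 : ((l + 1 - k : ℕ) : ℝ) = l - k + 1 := by
            rw [Nat.cast_sub (by omega)]
            push_cast
            ring
          have h2 : ((m - (l + 1) : ℕ) : ℝ) = m - l - 1 := by
            rw [Nat.cast_sub (by omega)]
            push_cast
            ring
          rw [schurKernel, schurRatio, ← Real.sqrt_inv, inv_div, hsub, hsub2, h1, h2]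
          congr 2
          · ring
          · ring_nf
        rw [← mul_assoc, e1, ← mul_assoc, e2]
      · rw [if_neg hl, mul_zero, if_neg hl, zero_add]
        split_ifs
        · exact mul_nonneg (schurKernel_nonneg _ _) (hG _ _ _)
        · exact le_rfl
    · refine add_nonneg (Finset.sum_nonneg fun l _ => ?_) (Finset.sum_nonneg fun l _ => ?_)
      · split_ifs
        · exact mul_nonneg (schurKernel_nonneg _ _) (hG _ _ _)
        · exact le_rfl
      · split_ifs
        · exact mul_nonneg (schurKernel_nonneg _ _) (hG _ _ _)
        · exact le_rfl
  have hfirst : ∑ σ : Equiv.Perm (Fin n), ∑ k : Fin n, ∑ m : Fin n, ∑ l : Fin n,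
      (if k ≤ l ∧ l < m then
      schurKernel (m - l) (l - k) * G σ m l else 0) ≤
        8 * ∑ σ : Equiv.Perm (Fin n), ∑ u, ∑ v : Fin n, G σ u v := by
    rw [Finset.mul_sum]
    refine Finset.sum_le_sum fun σ _ => ?_
    rw [Finset.sum_comm, Finset.mul_sum]
    refine Finset.sum_le_sum fun m _ => ?_
    rw [Finset.sum_comm, Finset.mul_sum]
    refine Finset.sum_le_sum fun l _ => ?_
    by_cases hlm : l < m
    · have hlm' : (l : ℕ) < m := hlm
      have h := sum_schurKernel_comp_le (P := m - l) (by omega) (fun k : Fin n => k ≤ l)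
        (fun k => l - k) (by
          intro i j hi hj he
          rw [Fin.le_def] at hi hj
          exact Fin.ext (by omega))
      refine le_trans (le_of_eq ?_) (mul_le_mul_of_nonneg_right h (hG σ m l))
      rw [Finset.sum_mul]
      refine Finset.sum_congr rfl fun k _ => ?_
      simp only [hlm, and_true, ite_mul, zero_mul]
    · simp only [hlm, and_false, if_false, Finset.sum_const_zero]
      exact mul_nonneg (by norm_num) (hG _ _ _)
  have hsecond : ∑ σ : Equiv.Perm (Fin n), ∑ k : Fin n, ∑ m : Fin n, ∑ v : Fin n,
      (if k < v ∧ v ≤ m then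
      schurKernel (v - k) (m - v) * G (Fin.cycleIcc k m * σ) k v else 0) ≤
      8 * ∑ σ : Equiv.Perm (Fin n), ∑ u, ∑ v : Fin n, G σ u v := by
    have hre : ∑ σ : Equiv.Perm (Fin n), ∑ k : Fin n, ∑ m : Fin n, ∑ v : Fin n,
      (if k < v ∧ v ≤ m then
        schurKernel (v - k) (m - v) * G (Fin.cycleIcc k m * σ) k v else 0) =
        ∑ σ : Equiv.Perm (Fin n), ∑ k : Fin n, ∑ m : Fin n, ∑ v : Fin n,
      (if k < v ∧ v ≤ m then
        schurKernel (v - k) (m - v) * G σ k v else 0) := by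
      -- For fixed `k` and `m`, passing to the neighbouring order is a bijection of the orders, so
      -- its weights can be charged to `σ` itself.
      rw [Finset.sum_comm]
      conv_rhs => rw [Finset.sum_comm]
      refine Finset.sum_congr rfl fun k _ => ?_
      rw [Finset.sum_comm]
      conv_rhs => rw [Finset.sum_comm]
      refine Finset.sum_congr rfl fun m _ => ?_
      exact Equiv.sum_comp (Equiv.mulLeft (Fin.cycleIcc k m)) (fun σ => ∑ v : Fin n,
        if k < v ∧ v ≤ m then schurKernel (v - k) (m - v) * G σ k v else 0)
    rw [hre, Finset.mul_sum]
    refine Finset.sum_le_sum fun σ _ => ?_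
    rw [Finset.mul_sum]
    refine Finset.sum_le_sum fun k _ => ?_
    rw [Finset.sum_comm, Finset.mul_sum]
    refine Finset.sum_le_sum fun v _ => ?_
    by_cases hkv : k < v
    · have hkv' : (k : ℕ) < v := hkv
      have h := sum_schurKernel_comp_le (P := v - k) (by omega) (fun m : Fin n => v ≤ m)
        (fun m => m - v) (by
          intro i j hi hj he
          rw [Fin.le_def] at hi hj
          exact Fin.ext (by omega))
      refine le_trans (le_of_eq ?_) (mul_le_mul_of_nonneg_right h (hG σ k v))
      rw [Finset.sum_mul]
      refine Finset.sum_congr rfl fun m _ => ?_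
      simp only [hkv, true_and, ite_mul, zero_mul]
    · simp only [hkv, false_and, if_false, Finset.sum_const_zero]
      exact mul_nonneg (by norm_num) (hG _ _ _)
  have hsum := Finset.sum_le_sum (s := Finset.univ) fun σ _ =>
    Finset.sum_le_sum (s := Finset.univ) fun k _ =>
      Finset.sum_le_sum (s := Finset.univ) fun m _ => hterm σ k m
  refine hsum.trans ?_
  simp only [Finset.sum_add_distrib]
  linarith

end MovedRank

/-! ### The adversary bound -/

section Adversary

variable {n : ℕ} (A : QCircuit (Cell n))

/-- The state of the circuit after `t` queries to the comparison matrix of `σ`. -/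
def comparisonState (t : ℕ) (σ : Equiv.Perm (Fin n)) : QBasis (Cell n) A.w → ℂ :=
  A.state (bits (comparison σ)) t

/-- The total inner product of the states on neighbouring orders, weighted by inverse distance. -/
def adversaryWeight (t : ℕ) : ℝ :=
  ∑ σ : Equiv.Perm (Fin n), ∑ k : Fin n, ∑ m : Fin n, if k < m then 1 / ((m : ℝ) - k) *
    (star (comparisonState A t σ) ⬝ᵥ comparisonState A t (Fin.cycleIcc k m * σ)).re else 0

theorem adversaryWeight_zero :
    adversaryWeight A 0 = Fintype.card (Equiv.Perm (Fin n)) * inverseDistanceSum n := by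
  simp only [adversaryWeight, comparisonState, QCircuit.re_dotProduct_zero, mul_one]
  rw [Finset.sum_const, Finset.card_univ, nsmul_eq_mul]
  rfl

theorem adversaryWeight_final {out : QBasis (Cell n) A.w → Matrix (Fin n) (Fin n) Bool}
    (hA : LearnsWithBoundedError A out (halfGraphs n)) :
    adversaryWeight A A.T ≤
      17 / 18 * (Fintype.card (Equiv.Perm (Fin n)) * inverseDistanceSum n) := by
  rw [← adversaryWeight_zero A]
  simp only [adversaryWeight, Finset.mul_sum]
  refine Finset.sum_le_sum fun σ _ => Finset.sum_le_sum fun k _ => Finset.sum_le_sum fun m _ => ?_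
  split_ifs with hkm
  · have hpos : (0 : ℝ) ≤ 1 / ((m : ℝ) - k) := by
      have : ((k : ℕ) : ℝ) < (m : ℕ) := by exact_mod_cast hkm
      exact div_nonneg zero_le_one (by linarith)
    have h := A.re_dotProduct_final_le out (comparison_ne hkm σ) (hA _ (comparison_mem σ))
      (hA _ (comparison_mem _))
    have h0 := A.re_dotProduct_zero (bits (comparison σ))
      (bits (comparison (Fin.cycleIcc k m * σ)))
    simp only [comparisonState]
    rw [h0]
    have := mul_le_mul_of_nonneg_left h hpos
    linarith
  · simp

/-- The weight with which the two comparisons of the elements of ranks `u` and `v` are queried. -/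
def rankWeight (t : ℕ) (σ : Equiv.Perm (Fin n)) (u v : Fin n) : ℝ :=
  queryWeight (comparisonState A t σ) (σ.symm u, σ.symm v) +
    queryWeight (comparisonState A t σ) (σ.symm v, σ.symm u)

theorem sum_rankWeight (t : ℕ) (σ : Equiv.Perm (Fin n)) :
    ∑ u, ∑ v : Fin n, rankWeight A t σ u v = 2 := by
  have h : ∑ u, ∑ v : Fin n, queryWeight (comparisonState A t σ) (σ.symm u, σ.symm v) = 1 := by
    have h1 := sum_queryWeight (comparisonState A t σ)
    rw [comparisonState, A.sum_norm_sq_state] at h1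
    rw [← Fintype.sum_prod_type' (fun u v =>
      queryWeight (comparisonState A t σ) (σ.symm u, σ.symm v)), ← h1]
    exact Equiv.sum_comp (Equiv.prodCongr σ.symm σ.symm) (queryWeight (comparisonState A t σ))
  simp only [rankWeight, Finset.sum_add_distrib]
  rw [h, Finset.sum_comm, h]
  norm_num

/-- The rank weights of each order add up to 2, because each cell is counted for both orders of its
indices; the factor 16 of `schur_test` makes this 32. -/
theorem adversaryWeight_step (t : ℕ) :
    adversaryWeight A t - adversaryWeight A (t + 1) ≤
      32 * Fintype.card (Equiv.Perm (Fin n)) := by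
  have hschur := schur_test (rankWeight A t) fun σ u v =>
    add_nonneg (queryWeight_nonneg _ _) (queryWeight_nonneg _ _)
  simp only [sum_rankWeight, Finset.sum_const, Finset.card_univ, nsmul_eq_mul] at hschur
  refine le_trans ?_ (hschur.trans (by linarith))
  simp only [adversaryWeight, ← Finset.sum_sub_distrib]
  refine Finset.sum_le_sum fun σ _ => Finset.sum_le_sum fun k _ => Finset.sum_le_sum fun m _ => ?_
  split_ifs with hkm
  · have hpos : (0 : ℝ) ≤ 1 / ((m : ℝ) - k) := by
      have : ((k : ℕ) : ℝ) < (m : ℕ) := by exact_mod_cast hkm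
      exact div_nonneg zero_le_one (by linarith)
    rw [← mul_sub]
    refine mul_le_mul_of_nonneg_left ?_ hpos
    set c := Fin.cycleIcc k m with hc
    -- In a cell where the inputs differ, one element has rank `m` and the other a smaller rank, so
    -- the minimum is the rank of the passed element.
    set r : Cell n → ℝ := fun z => schurRatio k m (min (σ z.1) (σ z.2)) with hr
    have hstep := re_dotProduct_sub_oracle_le (bits (comparison σ)) (bits (comparison (c * σ)))
      (comparisonState A t σ) (comparisonState A t (c * σ)) r (by
        intro z hz
        have hz' := comparison_differ hkm σ (σ z.1) (σ z.2) (by simpa using hz)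
        refine schurRatio_pos ?_
        rcases hz' with ⟨_, _, h⟩ | ⟨_, _, h⟩
        · exact min_lt_iff.2 (Or.inr h)
        · exact min_lt_iff.2 (Or.inl h))
    have hsucc : (star (comparisonState A (t + 1) σ) ⬝ᵥ comparisonState A (t + 1) (c * σ)).re =
        (star (oracle (bits (comparison σ)) (comparisonState A t σ)) ⬝ᵥ
          oracle (bits (comparison (c * σ))) (comparisonState A t (c * σ))).re :=
      A.re_dotProduct_succ _ _ t
    rw [hsucc]
    refine hstep.trans ?_
    refine (sum_differ_le hkm σ (fun z => r z * queryWeight (comparisonState A t σ) z +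
      (r z)⁻¹ * queryWeight (comparisonState A t (c * σ)) z) fun z => ?_).trans ?_
    · have h1 := queryWeight_nonneg (comparisonState A t σ) z
      have h2 := queryWeight_nonneg (comparisonState A t (c * σ)) z
      have h3 : 0 ≤ r z := schurRatio_nonneg _ _ _
      positivity
    · refine Finset.sum_le_sum fun l _ => ?_
      split_ifs with hl
      · have : NeZero n := ⟨fun h => by subst h; exact k.elim0⟩
        have hk : (c * σ).symm k = σ.symm m := by
          rw [Equiv.symm_apply_eq, Equiv.Perm.mul_apply, Equiv.apply_symm_apply, hc,
            Fin.cycleIcc_of_last hkm.le]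
        have hl' : (c * σ).symm (c l) = σ.symm l := by
          rw [Equiv.symm_apply_eq, Equiv.Perm.mul_apply, Equiv.apply_symm_apply]
        simp only [rankWeight, hk, hl', hr, Equiv.apply_symm_apply, min_eq_right hl.2.le,
          min_eq_left hl.2.le]
        exact le_of_eq (by ring)
      · exact le_rfl
  · simp

/-- A fraction 1/18 of the initial weight has to be lost at a rate of at most `32 n!` per query, so
`(n / 2) log n ≤ 18 * 32 * T` with the natural logarithm. Changing to base 2 costs at most a factor
2, and `4 * 18 * 32 = 2304` is below 5000. -/
theorem quantum_lower_bound {out : QBasis (Cell n) A.w → Matrix (Fin n) (Fin n) Bool}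
    (hA : LearnsWithBoundedError A out (halfGraphs n)) :
    1 / 5000 * (n * Real.logb 2 n) ≤ A.T := by
  have hT : ∀ t, adversaryWeight A 0 - adversaryWeight A t ≤
      t * (32 * Fintype.card (Equiv.Perm (Fin n))) := by
    intro t
    induction t with
    | zero => simp
    | succ t ih =>
      have := adversaryWeight_step A t
      push_cast
      linarith
  have h1 := hT A.T
  have h2 := adversaryWeight_final A hA
  rw [adversaryWeight_zero] at h1
  have hcard : (0 : ℝ) < Fintype.card (Equiv.Perm (Fin n)) := by
    exact_mod_cast Fintype.card_pos
  have h3 : inverseDistanceSum n / 18 ≤ 32 * A.T := by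
    refine le_of_mul_le_mul_left ?_ hcard
    linarith
  have h4 := half_mul_log_le_inverseDistanceSum n
  have hlog : Real.logb 2 n ≤ 2 * Real.log n := by
    rcases Nat.eq_zero_or_pos n with rfl | hn
    · simp
    · rw [Real.logb, div_le_iff₀ (Real.log_pos (by norm_num))]
      have h5 : 1 / 2 ≤ Real.log 2 := by linarith [Real.log_two_gt_d9]
      have h6 : 0 ≤ Real.log n := Real.log_nonneg (by exact_mod_cast hn)
      nlinarith
  have h7 : (n : ℝ) * Real.logb 2 n ≤ n * (2 * Real.log n) :=
    mul_le_mul_of_nonneg_left hlog (Nat.cast_nonneg n)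
  have h8 : (0 : ℝ) ≤ A.T := Nat.cast_nonneg _
  linarith

end Adversary

end

theorem theorem3 :
    (∃ C : ℝ, 0 < C ∧ ∀ (n : ℕ) [NeZero n],
      ∃ search : Finset (Cell n) → (Cell n → Bool) → Alg (randomized (Cell n)) (Cell n),
        IsSearch search (fun s d => C * (s / d)) ∧
        LearnsInExpectation (quicksortLearner randAsk randPick search) (halfGraphs n)
          (C * (n * Real.logb 2 n ^ 2))) ∧
    (∃ C : ℝ, 0 < C ∧ ∀ (n : ℕ) [NeZero n],
      ∃ search : Finset (Cell n) → (Cell n → Bool) → Alg (quantum (Cell n)) (Cell n),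
        IsSearch search (fun s d => C * Real.sqrt (s / d)) ∧
        LearnsInExpectation (quicksortLearner quantAsk quantPick search) (halfGraphs n)
          (C * (n * Real.logb 2 n))) ∧
    (∃ c : ℝ, 0 < c ∧ ∀ (n : ℕ) [NeZero n] (A : QCircuit (Cell n))
      (out : QBasis (Cell n) A.w → Matrix (Fin n) (Fin n) Bool),
        LearnsWithBoundedError A out (halfGraphs n) →
          c * (n * Real.logb 2 n) ≤ A.T) :=
  ⟨⟨160, by norm_num, fun _ _ => randomized_learner⟩,
    ⟨6944, by norm_num, fun _ _ => quantum_learner⟩,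
    ⟨1 / 5000, by norm_num, fun _ _ A _ hA => quantum_lower_bound A hA⟩⟩
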